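/- Consider the following problem. The input is an integer $k$, a finite nonempty planar graph $G$ (given by its list of edges) and a set $\mathcal{D}$ of connected vertex sets of $G$ (each given by its list of elements); the task is to decide whether there are $k$ sets in $\mathcal{D}$ whose union is $V(G)$. Algorithms are deterministic random access machines, and running time is measured by the logarithmic cost. The Strong Exponential Time Hypothesis (SETH) states that for no $\epsilon>0$ and $c>0$ is there an algorithm that decides the satisfiability of every CNF formula (with clauses of arbitrary length) with $n$ variables and length $L$ in time $c\cdot(2-\epsilon)^n\cdot L^{c}$. Assume SETH. Then for every function $f:\mathbb{N}\to\mathbb{N}$ (in particular, for every computable one) and every $\epsilon>0$, there is no algorithm that solves this problem in time $f(k)\cdot(|\mathcal{D}|+|V(G)|)^{k-\epsilon}$. This holds even if the algorithm is required to work only for the parameter values $k$ in a given set $K\subseteq\mathbb{N}$ that contains some $k\ge 2$; for instance, only for one fixed $k\ge 2$. -/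

import Mathlib

/-! ### Random access machines with logarithmic cost -/

namespace RAM

/-- The arithmetic and bitwise operations of the machine (on natural numbers; subtraction is
truncated, division by zero gives zero). -/
inductive Op
  | add | sub | mul | div | mod | and | or | xor | shl | shr

def Op.eval : Op → ℕ → ℕ → ℕ
  | .add, a, b => a + b
  | .sub, a, b => a - b
  | .mul, a, b => a * b
  | .div, a, b => a / b
  | .mod, a, b => a % b
  | .and, a, b => a &&& b
  | .or, a, b => a ||| b
  | .xor, a, b => a ^^^ b
  | .shl, a, b => a <<< b
  | .shr, a, b => a >>> b

/-- Instructions. The arguments `r s t` name registers, `l` is a program line. -/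
inductive Instr
  /-- `R[r] := c` -/
  | const (r c : ℕ)
  /-- `R[r] := R[s] o R[t]` -/
  | op (o : Op) (r s t : ℕ)
  /-- `R[r] := M[R[s]]` -/
  | load (r s : ℕ)
  /-- `M[R[r]] := R[s]` -/
  | store (r s : ℕ)
  /-- if `R[r] = 0` then continue at line `l` -/
  | jz (r l : ℕ)

/-- A program is a finite list of instructions; it mentions only finitely many registers. -/
abbrev Program := List Instr

/-- A configuration: program counter, registers `R`, and the random access memory `M`. -/
structure Config where
  pc : ℕ
  reg : ℕ → ℕ
  mem : ℕ → ℕ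

/-- The effect of one instruction. -/
def Instr.exec : Instr → Config → Config
  | .const r c, σ => { σ with pc := σ.pc + 1, reg := Function.update σ.reg r c }
  | .op o r s t, σ =>
      { σ with pc := σ.pc + 1, reg := Function.update σ.reg r (o.eval (σ.reg s) (σ.reg t)) }
  | .load r s, σ =>
      { σ with pc := σ.pc + 1, reg := Function.update σ.reg r (σ.mem (σ.reg s)) }
  | .store r s, σ =>
      { σ with pc := σ.pc + 1, mem := Function.update σ.mem (σ.reg r) (σ.reg s) }
  | .jz r l, σ => { σ with pc := if σ.reg r = 0 then l else σ.pc + 1 }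

/-- The logarithmic cost of one instruction: one plus the bit lengths of all the numbers
(operands, results, memory addresses) that it handles. -/
def Instr.cost : Instr → Config → ℕ
  | .const _ c, _ => 1 + c.size
  | .op o _ s t, σ =>
      1 + (σ.reg s).size + (σ.reg t).size + (o.eval (σ.reg s) (σ.reg t)).size
  | .load _ s, σ => 1 + (σ.reg s).size + (σ.mem (σ.reg s)).size
  | .store r s, σ => 1 + (σ.reg r).size + (σ.reg s).size
  | .jz r _, σ => 1 + (σ.reg r).size

/-- `HaltsIn P σ t τ`: started in `σ`, the program `P` halts in the configuration `τ` after a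
computation of total cost `t`. A program halts when the program counter leaves it. -/
inductive HaltsIn (P : Program) : Config → ℕ → Config → Prop
  | halt (σ : Config) : P[σ.pc]? = none → HaltsIn P σ 0 σ
  | step (σ τ : Config) (i : Instr) (t : ℕ) : P[σ.pc]? = some i →
      HaltsIn P (i.exec σ) t τ → HaltsIn P σ (i.cost σ + t) τ

/-- The initial configuration: the input is written in the memory cells `0, 1, 2, …`, and all
other cells and all registers are zero. -/
def init (x : List ℕ) : Config where
  pc := 0
  reg := fun _ => 0
  mem := fun i => x.getD i 0

/-- On input `x`, the program `P` halts within time `T` and answers correctly whether `p` holds: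
register `0` finally holds `1` if `p` is true and `0` if `p` is false. -/
def DecidesWithin (P : Program) (x : List ℕ) (p : Prop) (T : ℝ) : Prop :=
  ∃ (t : ℕ) (τ : Config), HaltsIn P (init x) t τ ∧ (t : ℝ) ≤ T ∧
    (p → τ.reg 0 = 1) ∧ (¬ p → τ.reg 0 = 0)

end RAM

/-! ### CNF satisfiability and the Strong Exponential Time Hypothesis -/

/-- CNF formulas over the variables `0, …, n - 1`: lists of clauses, each of which is a list of
literals (variable, sign), of arbitrary length. -/
abbrev CNFFormula (n : ℕ) := List (List (Fin n × Bool))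

namespace CNFFormula

def Satisfiable {n : ℕ} (φ : CNFFormula n) : Prop :=
  ∃ a : Fin n → Bool, ∀ C ∈ φ, ∃ l ∈ C, a l.1 = l.2

/-- The input that represents `φ`: the number of variables, the number of clauses, and every clause
as its length followed by its literals. -/
def encode {n : ℕ} (φ : CNFFormula n) : List ℕ :=
  n :: φ.length ::
    φ.flatMap fun C => C.length :: C.map fun l => 2 * (l.1 : ℕ) + l.2.toNat

end CNFFormula

/-- The Strong Exponential Time Hypothesis: for no `ε > 0` can the satisfiability of `n`-variable
CNF formulas be decided in time `(2 - ε) ^ n`, up to a factor polynomial in the length of the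
formula. -/
def SETH : Prop :=
  ∀ ε : ℝ, 0 < ε → ε < 1 →
    ¬ ∃ (P : RAM.Program) (c : ℕ), ∀ (n : ℕ) (φ : CNFFormula n),
      RAM.DecidesWithin P φ.encode φ.Satisfiable
        (c * (2 - ε) ^ n * (φ.encode.length : ℝ) ^ c)

/-! ### Covering a planar graph by connected vertex sets -/

/-- A graph is planar if it can be drawn in the plane: the vertices are distinct points, every edge
is a simple arc between its endpoints, an arc contains no vertex besides its endpoints, and two
different arcs meet only in common endpoints. -/
def SimpleGraph.IsPlanar {V : Type*} (G : SimpleGraph V) : Prop :=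
  ∃ (pt : V → ℝ × ℝ) (arc : Sym2 V → Set (ℝ × ℝ)),
    Function.Injective pt ∧
    (∀ u v, G.Adj u v → ∃ γ : _root_.Path (pt u) (pt v),
      Function.Injective γ ∧ Set.range γ = arc s(u, v)) ∧
    (∀ e ∈ G.edgeSet, ∀ w, pt w ∈ arc e → w ∈ e) ∧
    (∀ e ∈ G.edgeSet, ∀ e' ∈ G.edgeSet, e ≠ e' →
      ∀ z ∈ arc e ∩ arc e', ∃ w, w ∈ e ∧ w ∈ e' ∧ pt w = z)

/-- A (nonempty, finite) planar graph `G` with a set `Obj` of connected vertex sets. -/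
structure PlanarCoverInstance where
  n : ℕ
  n_pos : 0 < n
  G : SimpleGraph (Fin n)
  planar : G.IsPlanar
  Obj : Finset (Finset (Fin n))
  connected : ∀ S ∈ Obj, (G.induce (S : Set (Fin n))).Connected

namespace PlanarCoverInstance

/-- There are `k` sets in `Obj` whose union is the whole vertex set. -/
def HasCover (I : PlanarCoverInstance) (k : ℕ) : Prop :=
  ∃ F ⊆ I.Obj, F.card = k ∧ ∀ v, ∃ S ∈ F, v ∈ S

/-- `x` represents the instance `I` with parameter `k`: it lists `k`, the number of vertices, the
number of edges, the edges (each once, as a pair with the smaller endpoint first), the number of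
sets, and the sets (each once, as its size followed by its elements). Edges, sets and the elements
of a set may come in any order. -/
def IsEncoding (I : PlanarCoverInstance) (k : ℕ) (x : List ℕ) : Prop :=
  ∃ (es : List (Fin I.n × Fin I.n)) (ss : List (List (Fin I.n))),
    es.Nodup ∧ (∀ u v, (u, v) ∈ es ↔ u < v ∧ I.G.Adj u v) ∧
    (∀ s ∈ ss, s.Nodup) ∧ (ss.map List.toFinset).Nodup ∧
    (∀ S, S ∈ ss.map List.toFinset ↔ S ∈ I.Obj) ∧
    x = [k, I.n, es.length] ++ es.flatMap (fun e => [(e.1 : ℕ), (e.2 : ℕ)]) ++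
      [ss.length] ++ ss.flatMap (fun s => s.length :: s.map fun v => (v : ℕ))

end PlanarCoverInstance

/-! ### Stars are planar -/

/-! Fix one `k ≥ 2` in `K` and split the `n` variables of a formula into `k` groups of `g = n / k +
1` consecutive ones. Every partial assignment of a group becomes a set of vertices of a star: the
center and some leaves. A leaf for every group, contained only in the sets of that group, forces a
cover by `k` sets to take exactly one set per group, that is, one assignment of all variables. A
leaf for every clause, contained in the sets whose partial assignment makes one of its literals
true, is then covered iff the assignment satisfies the clause (`SatCover.hasCover_iff`). A leaf for
every variable only keeps sets of different partial assignments distinct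
(`SatCover.object_injective`). Stars are planar, and sets that contain the center are connected.

The instance has size `N = 2 ^ (n / k)` up to factors polynomial in `n` and the length of the
formula. Time `f k * N ^ (k - ε)`, where `ε ≤ 1` may be assumed, therefore decides satisfiability in
time `(2 ^ (1 - ε / k)) ^ n` up to such factors. The base is smaller than `2`, which contradicts
SETH. As `k` is fixed, `f k` is a constant, so nothing about `f` matters.

The rest is about the machine model, since the reduction has to be a program of bounded logarithmic
cost. It is written in a small language of bounded loops with a clock that controls the size of all
values, so that compilation multiplies the time by the bit length of these values only
(`LoopLang.correct_of_wf`). The instance is written behind the input (`LoopLang.eval_reduction`),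
and the assumed algorithm runs on it after its registers and addresses are shifted
(`RAM.Relocated.halts`). -/

theorem SimpleGraph.isPlanar_starGraph (U : ℕ) :
    (SimpleGraph.starGraph (0 : Fin (U + 1))).IsPlanar := by
  -- The center is the origin, the leaves lie on the line with first coordinate `1`, and the edges
  -- are segments of pairwise different slopes.
  let pt : Fin (U + 1) → ℝ × ℝ := fun v => if v = 0 then (0, 0) else (1, (v : ℕ))
  have pt0 : pt 0 = (0, 0) := if_pos rfl
  have ptv : ∀ v, v ≠ 0 → pt v = (1, ((v : ℕ) : ℝ)) := fun v hv => if_neg hv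
  let arc : Sym2 (Fin (U + 1)) → Set (ℝ × ℝ) := fun e =>
    {z | ∃ v ∈ e, v ≠ 0 ∧ ∃ t ∈ Set.Icc (0 : ℝ) 1, z = (t, t * (v : ℕ))}
  have ray : ∀ v : Fin (U + 1), v ≠ 0 → ∃ γ : _root_.Path (pt 0) (pt v),
      Function.Injective γ ∧ Set.range γ = arc s(0, v) := by
    intro v hv
    refine ⟨⟨⟨fun t => ((t : ℝ), (t : ℝ) * (v : ℕ)), by fun_prop⟩, ?_, ?_⟩, ?_, ?_⟩
    · simp [pt0]
    · simp [ptv v hv]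
    · intro s t h
      exact Subtype.ext (congrArg Prod.fst h)
    · ext z
      constructor
      · rintro ⟨t, rfl⟩
        exact ⟨v, by simp, hv, t, t.2, rfl⟩
      · rintro ⟨w, hw, hw0, t, ht, rfl⟩
        obtain rfl : w = v := by simpa [hw0] using hw
        exact ⟨⟨t, ht⟩, rfl⟩
  have edge : ∀ e ∈ (SimpleGraph.starGraph (0 : Fin (U + 1))).edgeSet,
      ∃ v, v ≠ 0 ∧ e = s(0, v) := by
    intro e he
    induction e with | _ u v
    obtain ⟨huv, rfl | rfl⟩ := SimpleGraph.starGraph_adj.1 he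
    · exact ⟨v, huv.symm, rfl⟩
    · exact ⟨u, huv, Sym2.eq_swap⟩
  refine ⟨pt, arc, ?_, ?_, ?_, ?_⟩
  · intro u v h
    by_cases hu : u = 0 <;> by_cases hv : v = 0
    · rw [hu, hv]
    · simp [hu, pt0, ptv v hv] at h
    · simp [hv, pt0, ptv u hu] at h
    · simpa [ptv u hu, ptv v hv, Fin.val_inj] using h
  · intro u v huv
    obtain ⟨hne, rfl | rfl⟩ := SimpleGraph.starGraph_adj.1 huv
    · exact ray v hne.symm
    · obtain ⟨γ, hγ, hr⟩ := ray u hne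
      refine ⟨γ.symm, ?_, ?_⟩
      · exact hγ.comp unitInterval.symm_bijective.injective
      · rw [_root_.Path.symm_range, hr, Sym2.eq_swap]
  · intro e he w hw
    obtain ⟨v, hv, rfl⟩ := edge e he
    by_cases hw0 : w = 0
    · simp [hw0]
    obtain ⟨v', hv', hv0, t, -, h⟩ := hw
    obtain rfl : v' = v := by simpa [hv0] using hv'
    rw [ptv w hw0, Prod.mk.injEq] at h
    obtain ⟨rfl, h⟩ := h
    have : w = v' := by simpa [Fin.val_inj] using h
    simp [this]
  · intro e he e' he' hne z hz
    obtain ⟨v, hv, rfl⟩ := edge e he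
    obtain ⟨v', hv', rfl⟩ := edge e' he'
    obtain ⟨⟨u, hu, hu0, t, -, rfl⟩, ⟨u', hu', hu0', t', -, h⟩⟩ := hz
    obtain rfl : u = v := by simpa [hu0] using hu
    obtain rfl : u' = v' := by simpa [hu0'] using hu'
    refine ⟨0, by simp, by simp, ?_⟩
    rw [Prod.mk.injEq] at h
    obtain ⟨rfl, h⟩ := h
    -- A common point has the same first coordinate `t` on both segments, so either the slopes agree
    -- or `t = 0`, which is the origin.
    rcases mul_eq_mul_left_iff.1 h with h | rfl
    · exact absurd (by rw [Fin.ext (Nat.cast_injective h)]) hne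
    · simp [pt0]

theorem SimpleGraph.connected_induce_starGraph {V : Type*} {r : V} {S : Set V} (h : r ∈ S) :
    ((SimpleGraph.starGraph r).induce S).Connected := by
  have key : ∀ v : S, ((SimpleGraph.starGraph r).induce S).Reachable ⟨r, h⟩ v := by
    intro v
    by_cases hv : r = v
    · have : v = ⟨r, h⟩ := Subtype.ext hv.symm
      rw [this]
    · exact SimpleGraph.Adj.reachable (SimpleGraph.starGraph_center_adj hv)
  exact { preconnected := fun u v => (key u).symm.trans (key v), nonempty := ⟨⟨r, h⟩⟩ }

/-! ### Satisfiability as a covering problem -/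

namespace SatCover

/-- The variables are split into groups of `g` consecutive ones. `agrees g i w t` says that the
literal with code `t` belongs to a variable of group `i` and is made true by the partial assignment
that gives the variables of this group the binary digits of `w`. -/
def agrees (g i w t : ℕ) : Bool :=
  decide (t / 2 / g = i ∧ (w.testBit (t / 2 % g)).toNat = t % 2)

/-- The number of leaves of the star: `k` leaves for the groups, `k * g` for the variables, and one
for every clause. -/
def leaves (k g : ℕ) (cs : List (List ℕ)) : ℕ := k + k * g + cs.length

/-- `covers k g cs i w v` says that the vertex `v` belongs to the set that represents the partial
assignment `w` of the variables in group `i`. -/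
def covers (k g : ℕ) (cs : List (List ℕ)) (i w v : ℕ) : Bool :=
  if v = 0 then true
  else if v < k + 1 then decide (v = i + 1)
  else if v < k + 1 + k * g then !agrees g i w (2 * (v - (k + 1)))
  else (cs.getD (v - (k + 1 + k * g)) []).any (agrees g i w)

variable {k g : ℕ} {cs : List (List ℕ)}

def object (k g : ℕ) (cs : List (List ℕ)) (i w : ℕ) : Finset (Fin (leaves k g cs + 1)) :=
  Finset.univ.filter fun v => covers k g cs i w v

theorem mem_object {i w : ℕ} {v : Fin (leaves k g cs + 1)} :
    v ∈ object k g cs i w ↔ covers k g cs i w v = true := by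
  simp [object]

theorem covers_zero {i w : ℕ} : covers k g cs i w 0 = true := if_pos rfl

theorem covers_group {i j w : ℕ} (hj : j < k) : covers k g cs i w (j + 1) = true ↔ j = i := by
  simp [covers, hj]

/-- The code `2 * x` is the negative literal of `x`. Hence the leaf of `x` is missing only from sets
of its own group, and in a cover with `k ≥ 2` a set of another group takes care of it. -/
theorem covers_variable {i w x : ℕ} (hx : x < k * g) :
    covers k g cs i w (k + 1 + x) = true ↔ (x / g = i → w.testBit (x % g) = true) := by
  have h1 : k + 1 + x ≠ 0 := by omega
  have h2 : ¬ k + 1 + x < k + 1 := by omega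
  have h3 : k + 1 + x < k + 1 + k * g := by omega
  rw [covers, if_neg h1, if_neg h2, if_pos h3]
  simp [agrees, imp_iff_not_or]

theorem covers_clause {i w j : ℕ} (hj : j < cs.length) :
    covers k g cs i w (k + 1 + k * g + j) = true ↔ ∃ t ∈ cs[j], agrees g i w t = true := by
  have h1 : k + 1 + k * g + j ≠ 0 := by omega
  have h2 : ¬ k + 1 + k * g + j < k + 1 := by omega
  have h3 : ¬ k + 1 + k * g + j < k + 1 + k * g := by omega
  rw [covers, if_neg h1, if_neg h2, if_neg h3]
  simp [hj]

theorem div_lt_of_lt_groups {x : ℕ} (hx : x < k * g) : x / g < k :=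
  Nat.div_lt_of_lt_mul (by rwa [mul_comm] at hx)

/-- The variable leaves exist for this: two partial assignments may satisfy the same clauses. The
group leaves determine `i`, and the variable leaves of group `i` show the binary digits of `w`. -/
theorem object_injective {i i' w w' : ℕ} (hi : i < k) (hw : w < 2 ^ g)
    (hw' : w' < 2 ^ g) (h : object k g cs i w = object k g cs i' w') : i = i' ∧ w = w' := by
  have key : ∀ v < leaves k g cs + 1, covers k g cs i w v = true ↔ covers k g cs i' w' v = true := by
    intro v hv
    have := congrArg (fun S => (⟨v, hv⟩ : Fin (leaves k g cs + 1)) ∈ S) h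
    simpa [mem_object] using this
  have hii : i = i' := by
    have := key (i + 1) (by simp [leaves]; omega)
    rw [covers_group hi, covers_group hi] at this
    exact this.1 rfl
  subst hii
  refine ⟨rfl, Nat.eq_of_testBit_eq fun b => ?_⟩
  by_cases hb : b < g
  · have hx : i * g + b < k * g := by nlinarith
    have := key (k + 1 + (i * g + b)) (by simp [leaves]; omega)
    rw [covers_variable hx, covers_variable hx] at this
    have e1 : (i * g + b) / g = i := by
      rw [mul_comm, Nat.mul_add_div (by omega), Nat.div_eq_of_lt hb, add_zero]
    have e2 : (i * g + b) % g = b := by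
      rw [mul_comm, Nat.mul_add_mod, Nat.mod_eq_of_lt hb]
    rw [e1, e2] at this
    rw [Bool.eq_iff_iff]
    simpa using this
  · have hp : 2 ^ g ≤ 2 ^ b := Nat.pow_le_pow_right (by norm_num) (by omega)
    rw [Nat.testBit_lt_two_pow (hw.trans_le hp), Nat.testBit_lt_two_pow (hw'.trans_le hp)]

/-- All pairs of a group and a partial assignment. -/
def pairs (k g : ℕ) : List (ℕ × ℕ) := List.range k ×ˢ List.range (2 ^ g)

theorem mem_pairs {q : ℕ × ℕ} : q ∈ pairs k g ↔ q.1 < k ∧ q.2 < 2 ^ g := by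
  obtain ⟨i, w⟩ := q
  simp [pairs]

theorem nodup_pairs : (pairs k g).Nodup := List.nodup_range.product List.nodup_range

def objects (k g : ℕ) (cs : List (List ℕ)) : Finset (Finset (Fin (leaves k g cs + 1))) :=
  ((pairs k g).map fun q => object k g cs q.1 q.2).toFinset

theorem mem_objects {S : Finset (Fin (leaves k g cs + 1))} :
    S ∈ objects k g cs ↔ ∃ i w, i < k ∧ w < 2 ^ g ∧ object k g cs i w = S := by
  simp [objects, mem_pairs, and_assoc]

theorem length_pairs : (pairs k g).length = k * 2 ^ g := by
  rw [pairs, List.length_product, List.length_range, List.length_range]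

theorem card_objects_le : (objects k g cs).card ≤ k * 2 ^ g := by
  refine (List.toFinset_card_le _).trans ?_
  rw [List.length_map, length_pairs]

def planarInstance (k g : ℕ) (cs : List (List ℕ)) : PlanarCoverInstance where
  n := leaves k g cs + 1
  n_pos := Nat.succ_pos _
  G := SimpleGraph.starGraph 0
  planar := SimpleGraph.isPlanar_starGraph _
  Obj := objects k g cs
  connected := by
    intro S hS
    obtain ⟨i, w, -, -, rfl⟩ := mem_objects.1 hS
    exact SimpleGraph.connected_induce_starGraph (by simp [mem_object, covers_zero])

theorem hasCover_planarInstance : (planarInstance k g cs).HasCover k ↔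
    ∃ F ⊆ objects k g cs, F.card = k ∧ ∀ v, ∃ S ∈ F, v ∈ S := Iff.rfl

/-- The list of vertices in the set of a partial assignment. -/
def members (k g : ℕ) (cs : List (List ℕ)) (i w : ℕ) : List ℕ :=
  (List.range (leaves k g cs + 1)).filter (covers k g cs i w)

/-- The input that represents the instance. -/
def encoding (k g : ℕ) (cs : List (List ℕ)) : List ℕ :=
  [k, leaves k g cs + 1, leaves k g cs] ++
    (List.range (leaves k g cs)).flatMap (fun v => [0, v + 1]) ++ [k * 2 ^ g] ++
    (List.range k).flatMap fun i => (List.range (2 ^ g)).flatMap fun w =>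
      (members k g cs i w).length :: members k g cs i w

theorem isEncoding_encoding : (planarInstance k g cs).IsEncoding k (encoding k g cs) := by
  let N := leaves k g cs
  let es : List (Fin (N + 1) × Fin (N + 1)) := (List.finRange N).map fun v => (0, v.succ)
  let obj : ℕ × ℕ → List (Fin (N + 1)) := fun q =>
    (List.finRange (N + 1)).filter fun v => covers k g cs q.1 q.2 v
  have obj_eq : ∀ q, (obj q).toFinset = object k g cs q.1 q.2 := by
    intro q
    ext v
    simp [obj, mem_object]
  -- Where the bound variable carries no type, the coercion to `ℕ` is applied to the whole list,
  -- through the list monad. This identifies the result with the entrywise coercion.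
  have vals : ∀ s : List (Fin (N + 1)),
      (s.map fun v => (v : ℕ)) = s.map fun v : Fin (N + 1) => (v : ℕ) := by
    intro s
    simp only [List.map_id', bind, pure]
    exact List.map_eq_flatMap.symm
  have obj_val : ∀ q, (obj q).map (fun v : Fin (N + 1) => (v : ℕ)) = members k g cs q.1 q.2 := by
    intro q
    rw [members, ← List.map_coe_finRange_eq_range, List.filter_map]
    rfl
  change ∃ (es : List (Fin (N + 1) × Fin (N + 1))) (ss : List (List (Fin (N + 1)))),
    es.Nodup ∧ (∀ u v, (u, v) ∈ es ↔ u < v ∧ (SimpleGraph.starGraph 0).Adj u v) ∧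
    (∀ s ∈ ss, s.Nodup) ∧ (ss.map List.toFinset).Nodup ∧
    (∀ S, S ∈ ss.map List.toFinset ↔ S ∈ objects k g cs) ∧
    encoding k g cs = [k, N + 1, es.length] ++ es.flatMap (fun e => [(e.1 : ℕ), (e.2 : ℕ)]) ++
      [ss.length] ++ ss.flatMap (fun s => s.length :: s.map fun v => (v : ℕ))
  refine ⟨es, (pairs k g).map obj, ?_, ?_, ?_, ?_, ?_, ?_⟩
  · refine (List.nodup_finRange N).map fun u v h => ?_
    exact Fin.succ_injective _ (congrArg Prod.snd h)
  · intro u v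
    simp only [es, List.mem_map, List.mem_finRange, true_and, Prod.mk.injEq,
      SimpleGraph.starGraph_adj]
    constructor
    · rintro ⟨x, rfl, rfl⟩
      exact ⟨Fin.succ_pos x, (Fin.succ_pos x).ne, Or.inl rfl⟩
    · rintro ⟨hlt, -, rfl | rfl⟩
      · exact ⟨v.pred hlt.ne', rfl, Fin.succ_pred v _⟩
      · exact absurd hlt (Fin.not_lt_zero u)
  · intro s hs
    obtain ⟨q, -, rfl⟩ := List.mem_map.1 hs
    exact (List.nodup_finRange _).filter _
  · rw [List.map_map]
    refine List.Nodup.map_on ?_ nodup_pairs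
    intro q hq q' hq' h
    simp only [Function.comp, obj_eq] at h
    rw [mem_pairs] at hq hq'
    have := object_injective hq.1 hq.2 hq'.2 h
    exact Prod.ext this.1 this.2
  · intro S
    rw [mem_objects]
    simp only [List.map_map, List.mem_map, Function.comp, obj_eq, mem_pairs, Prod.exists, and_assoc]
  · have h1 : es.flatMap (fun e => [(e.1 : ℕ), (e.2 : ℕ)]) =
        (List.range N).flatMap fun v => [0, v + 1] := by
      rw [← List.map_coe_finRange_eq_range, List.flatMap_map, List.flatMap_map]
      rfl
    have h2 : ((pairs k g).map obj).flatMap (fun s => s.length :: s.map fun v : Fin (N + 1) => (v : ℕ)) =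
        (List.range k).flatMap fun i => (List.range (2 ^ g)).flatMap fun w =>
          (members k g cs i w).length :: members k g cs i w := by
      rw [List.flatMap_map]
      have : ∀ q, ((obj q).length :: (obj q).map fun v : Fin (N + 1) => (v : ℕ)) =
          (members k g cs q.1 q.2).length :: members k g cs q.1 q.2 := by
        intro q
        rw [obj_val, ← obj_val, List.length_map]
      simp only [this, pairs]
      change List.flatMap _ (List.flatMap _ _) = _
      rw [List.flatMap_assoc]
      simp [List.flatMap_map]
    have h3 : es.length = N := by simp [es]
    have h4 : ((pairs k g).map obj).length = k * 2 ^ g := by rw [List.length_map, length_pairs]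
    simp only [vals]
    rw [encoding, h3, h4, h1, h2]

/-- The codes of the literals of a formula. -/
def codes {n : ℕ} (φ : CNFFormula n) : List (List ℕ) :=
  φ.map fun C => C.map fun l => 2 * (l.1 : ℕ) + l.2.toNat

theorem agrees_code {n i w : ℕ} (l : Fin n × Bool) :
    agrees g i w (2 * (l.1 : ℕ) + l.2.toNat) = true ↔
      (l.1 : ℕ) / g = i ∧ w.testBit ((l.1 : ℕ) % g) = l.2 := by
  have h1 : (2 * (l.1 : ℕ) + l.2.toNat) / 2 = l.1 := by cases l.2 <;> simp; omega
  have h2 : (2 * (l.1 : ℕ) + l.2.toNat) % 2 = l.2.toNat := by cases l.2 <;> simp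
  rw [agrees, h1, h2]
  cases l.2 <;> simp

/-- A cover needs a set from each of the `k` groups for the group leaves and has only `k` sets, so
it amounts to one assignment. The condition `2 ≤ k` serves the converse, where the variable leaves
have to be covered. -/
theorem hasCover_iff {n : ℕ} (φ : CNFFormula n) (hk : 2 ≤ k) (hg : n ≤ k * g) :
    (planarInstance k g (codes φ)).HasCover k ↔ φ.Satisfiable := by
  have clause_vertex : ∀ (j : ℕ) (hj : j < φ.length) (i w : ℕ),
      covers k g (codes φ) i w (k + 1 + k * g + j) = true ↔
        ∃ l ∈ φ[j], (l.1 : ℕ) / g = i ∧ w.testBit ((l.1 : ℕ) % g) = l.2 := by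
    intro j hj i w
    rw [covers_clause (by simpa [codes] using hj)]
    simp [codes, -Prod.exists, agrees_code]
  rw [hasCover_planarInstance]
  constructor
  · rintro ⟨F, hF, hcard, hcov⟩
    replace hcov : ∀ v, v < leaves k g (codes φ) + 1 → ∃ i w, i < k ∧
        object k g (codes φ) i w ∈ F ∧ covers k g (codes φ) i w v = true := by
      intro v hv
      obtain ⟨S, hS, hvS⟩ := hcov ⟨v, hv⟩
      obtain ⟨i, w, hi, -, rfl⟩ := mem_objects.1 (hF hS)
      exact ⟨i, w, hi, hS, mem_object.1 hvS⟩
    have hgrp : ∀ i : Fin k, ∃ w, object k g (codes φ) i w ∈ F := by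
      intro i
      obtain ⟨i', w, -, hF', hc⟩ := hcov (i + 1) (by have := i.2; simp [leaves]; omega)
      rw [covers_group i.2] at hc
      exact ⟨w, hc ▸ hF'⟩
    choose w hw using hgrp
    -- The chosen numbers are not known to be below `2 ^ g`, as `object_injective` demands, so they
    -- are replaced by representatives that are.
    have hw_lt : ∀ i w', object k g (codes φ) i w' ∈ F → i < k →
        ∃ w'' < 2 ^ g, object k g (codes φ) i w'' = object k g (codes φ) i w' := by
      intro i w' h hi
      obtain ⟨i₁, w₁, h₁, h₂, h₃⟩ := mem_objects.1 (hF h)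
      have : i₁ = i := by
        have := congrArg (fun S => (⟨i₁ + 1, by simp [leaves]; omega⟩ :
          Fin (leaves k g (codes φ) + 1)) ∈ S) h₃
        simpa [mem_object, covers_group h₁] using this
      subst this
      exact ⟨w₁, h₂, h₃⟩
    choose! r hr hr' using hw_lt
    have inj : Function.Injective fun i : Fin k => object k g (codes φ) i (w i) := by
      intro i j hij
      simp only at hij
      rw [← hr' i _ (hw i) i.2, ← hr' j _ (hw j) j.2] at hij
      exact Fin.ext (object_injective i.2 (hr i _ (hw i) i.2) (hr j _ (hw j) j.2) hij).1
    -- One set per group already gives `k` different members of `F`, hence all of `F`.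
    have himg : Finset.univ.image (fun i : Fin k => object k g (codes φ) i (w i)) = F := by
      refine Finset.eq_of_subset_of_card_le ?_ ?_
      · intro S hS
        obtain ⟨i, -, rfl⟩ := Finset.mem_image.1 hS
        exact hw i
      · rw [Finset.card_image_of_injective _ inj, Finset.card_univ, Fintype.card_fin, hcard]
    refine ⟨fun x => (w ⟨x / g, div_lt_of_lt_groups (x.2.trans_le hg)⟩).testBit (x % g), ?_⟩
    intro C hC
    obtain ⟨j, hj, rfl⟩ := List.getElem_of_mem hC
    have hjv : k + 1 + k * g + j < leaves k g (codes φ) + 1 := by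
      simp [leaves, codes]; omega
    obtain ⟨i, w', hi, hF', hc⟩ := hcov _ hjv
    rw [← himg] at hF'
    obtain ⟨i', -, hi'⟩ := Finset.mem_image.1 hF'
    have hc' : covers k g (codes φ) i' (w i') (k + 1 + k * g + j) = true := by
      have : (⟨_, hjv⟩ : Fin _) ∈ object k g (codes φ) i w' := mem_object.2 hc
      rw [← hi'] at this
      exact mem_object.1 this
    obtain ⟨l, hl, h1, h2⟩ := (clause_vertex j hj _ _).1 hc'
    refine ⟨l, hl, ?_⟩
    have : (⟨(l.1 : ℕ) / g, div_lt_of_lt_groups (l.1.2.trans_le hg)⟩ : Fin k) = i' := Fin.ext h1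
    simp only [this, h2]
  · rintro ⟨a, ha⟩
    -- The groups may contain more than `n` variables; the surplus ones are set to false.
    let b : ℕ → Bool := fun x => if h : x < n then a ⟨x, h⟩ else false
    let w : ℕ → ℕ := fun i => Nat.ofBits fun c : Fin g => b (i * g + c)
    have hwlt : ∀ i, w i < 2 ^ g := fun i => Nat.ofBits_lt_two_pow _
    have inj : Set.InjOn (fun i => object k g (codes φ) i (w i)) (Finset.range k) := by
      intro i hi j hj hij
      exact (object_injective (by simpa using hi) (hwlt i) (hwlt j) hij).1
    have hmem : ∀ i < k, object k g (codes φ) i (w i) ∈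
        (Finset.range k).image fun i => object k g (codes φ) i (w i) := fun i hi =>
      Finset.mem_image_of_mem _ (Finset.mem_range.2 hi)
    refine ⟨(Finset.range k).image fun i => object k g (codes φ) i (w i), ?_, ?_, ?_⟩
    · intro S hS
      obtain ⟨i, hi, rfl⟩ := Finset.mem_image.1 hS
      exact mem_objects.2 ⟨i, w i, Finset.mem_range.1 hi, hwlt i, rfl⟩
    · rw [Finset.card_image_of_injOn inj, Finset.card_range]
    · intro v
      suffices ∃ i < k, covers k g (codes φ) i (w i) v = true by
        obtain ⟨i, hi, hc⟩ := this
        exact ⟨_, hmem i hi, mem_object.2 hc⟩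
      obtain ⟨v, hv⟩ := v
      simp only
      rcases Nat.eq_zero_or_pos v with rfl | hv0
      · exact ⟨0, by omega, covers_zero⟩
      by_cases h1 : v < k + 1
      · obtain ⟨i, rfl⟩ := Nat.exists_eq_add_of_le' hv0
        exact ⟨i, by omega, (covers_group (by omega)).2 rfl⟩
      by_cases h2 : v < k + 1 + k * g
      · obtain ⟨x, rfl⟩ := Nat.exists_eq_add_of_le (not_lt.1 h1)
        have hx : x < k * g := by omega
        -- One of the groups `0` and `1` is not the group of `x`, and all its sets contain the leaf.
        obtain ⟨i, hi, hne⟩ : ∃ i < k, x / g ≠ i := by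
          by_cases h : x / g = 0
          · exact ⟨1, by omega, by omega⟩
          · exact ⟨0, by omega, h⟩
        exact ⟨i, hi, (covers_variable hx).2 fun h => absurd h hne⟩
      · obtain ⟨j, rfl⟩ := Nat.exists_eq_add_of_le (not_lt.1 h2)
        have hj : j < φ.length := by
          simp [leaves, codes] at hv
          omega
        obtain ⟨l, hl, hal⟩ := ha φ[j] (List.getElem_mem hj)
        have hlt : (l.1 : ℕ) < k * g := l.1.2.trans_le hg
        have hg0 : 0 < g := Nat.pos_of_ne_zero fun h => by simp [h] at hlt
        refine ⟨(l.1 : ℕ) / g, div_lt_of_lt_groups hlt, ?_⟩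
        refine (clause_vertex j hj _ _).2 ⟨l, hl, rfl, ?_⟩
        rw [Nat.testBit_ofBits_lt _ _ (Nat.mod_lt _ hg0)]
        have hx : (l.1 : ℕ) / g * g + (l.1 : ℕ) % g = l.1 := Nat.div_add_mod' _ _
        simp only [b, hx, l.1.2, dif_pos]
        exact hal

end SatCover

/-! ### Computations and pieces of code -/

namespace RAM

/-- Started in `σ`, the program `P` comes to `σ'` by a computation of total cost `t`. -/
def Reaches (P : Program) (σ : Config) (t : ℕ) (σ' : Config) : Prop :=
  ∀ t' τ, HaltsIn P σ' t' τ → HaltsIn P σ (t + t') τ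

theorem Reaches.refl (P : Program) (σ : Config) : Reaches P σ 0 σ := fun t' τ h => by
  rwa [zero_add]

theorem Reaches.trans {P : Program} {σ₁ σ₂ σ₃ : Config} {t₁ t₂ : ℕ} (h₁ : Reaches P σ₁ t₁ σ₂)
    (h₂ : Reaches P σ₂ t₂ σ₃) : Reaches P σ₁ (t₁ + t₂) σ₃ := fun t' τ h => by
  rw [add_assoc]
  exact h₁ _ _ (h₂ _ _ h)

theorem Reaches.step {P : Program} {σ : Config} {i : Instr} (h : P[σ.pc]? = some i) :
    Reaches P σ (i.cost σ) (i.exec σ) := fun t' τ h' => HaltsIn.step σ τ i t' h h'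

/-- The list `code` is the part of the program `P` that begins at line `l`. -/
def CodeAt (P : Program) (l : ℕ) (code : List Instr) : Prop :=
  ∀ j < code.length, P[l + j]? = code[j]?

theorem codeAt_cons {P : Program} {l : ℕ} {i : Instr} {c : List Instr} :
    CodeAt P l (i :: c) ↔ P[l]? = some i ∧ CodeAt P (l + 1) c := by
  constructor
  · intro h
    refine ⟨h 0 (by simp), fun j hj => ?_⟩
    have := h (j + 1) (by simpa using hj)
    rwa [add_comm j 1, ← add_assoc, add_comm 1 j, List.getElem?_cons_succ] at this
  · rintro ⟨h₀, h⟩ j hj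
    cases j with
    | zero => exact h₀
    | succ j =>
      rw [add_comm j 1, ← add_assoc, h j (by simpa using hj)]
      simp [add_comm 1 j]

theorem codeAt_append {P : Program} {l : ℕ} {c d : List Instr} :
    CodeAt P l (c ++ d) ↔ CodeAt P l c ∧ CodeAt P (l + c.length) d := by
  induction c generalizing l with
  | nil => simp [CodeAt]
  | cons i c ih =>
    rw [List.cons_append, codeAt_cons, codeAt_cons, ih, and_assoc, List.length_cons,
      add_assoc l 1, add_comm 1]

theorem codeAt_self (c d e : List Instr) : CodeAt (c ++ d ++ e) c.length d := by
  intro j hj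
  rw [List.append_assoc, List.getElem?_append_right (by omega), Nat.add_sub_cancel_left,
    List.getElem?_append_left hj]

end RAM

/-! ### A language of bounded loops, and its compiler -/

namespace LoopLang

open RAM

/-- The registers that are visible to the language. -/
inductive Reg
  | n | m | k | g | kg | u | o | base | p | len | i | w | e | v | q | lit | a | b | d | flag | sat
  | total | zero | one | two | c₁ | c₂ | c₃ | c₄
  deriving DecidableEq

def Reg.idx : Reg → ℕ
  | n => 1 | m => 2 | k => 3 | g => 4 | kg => 5 | u => 6 | o => 7 | base => 8 | p => 9 | len => 10
  | i => 11 | w => 12 | e => 13 | v => 14 | q => 15 | lit => 16 | a => 17 | b => 18 | d => 19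
  | flag => 20 | sat => 21 | total => 22 | zero => 23 | one => 24 | two => 25 | c₁ => 26
  | c₂ => 27 | c₃ => 28 | c₄ => 29

theorem Reg.idx_injective : Function.Injective Reg.idx := by
  intro r s h
  cases r <;> cases s <;> first | rfl | simp [Reg.idx] at h

theorem Reg.idx_pos (r : Reg) : r.idx ≠ 0 := by cases r <;> simp [Reg.idx]

theorem Reg.idx_lt (r : Reg) : r.idx < 30 := by cases r <;> simp [Reg.idx]

/-- States: registers, memory, and a clock. -/
structure St where
  reg : Reg → ℕ
  mem : ℕ → ℕ
  t : ℕ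

/-- Commands. The command `loop c b` repeats `b` as often as the register `c` says, which is
counted down. -/
inductive Cmd
  | set (r : Reg) (c : ℕ)
  | inc (r : Reg)
  | op (o : Op) (r s t : Reg)
  | load (r s : Reg)
  | store (r s : Reg)
  | seq (a b : Cmd)
  | loop (c : Reg) (b : Cmd)

/-- Every pass and the final test take one unit of time. Assigning `j` to the counter agrees with
decrementing it as long as the body leaves the counter alone. -/
def iterate (f : St → St) (c : Reg) : ℕ → St → St
  | 0, s => { s with t := s.t + 1 }
  | j + 1, s => iterate f c j { f s with reg := Function.update (f s).reg c j, t := (f s).t + 1 }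

/-- The clock has to dominate the growth of all values. This is why `set` is charged for the
constant `c`, while `inc` needs one unit only. -/
def Cmd.eval : Cmd → St → St
  | set r c, s => { s with reg := Function.update s.reg r c, t := s.t + c + 1 }
  | inc r, s => { s with reg := Function.update s.reg r (s.reg r + 1), t := s.t + 1 }
  | op o r x y, s =>
      { s with reg := Function.update s.reg r (o.eval (s.reg x) (s.reg y)), t := s.t + 1 }
  | load r x, s => { s with reg := Function.update s.reg r (s.mem (s.reg x)), t := s.t + 1 }
  | store r x, s => { s with mem := Function.update s.mem (s.reg r) (s.reg x), t := s.t + 1 }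
  | seq a b, s => b.eval (a.eval s)
  | loop c b, s => iterate b.eval c (s.reg c) s

/-- The command does not change the register `r`. -/
def Cmd.keeps (r : Reg) : Cmd → Bool
  | set r' _ => r ≠ r'
  | inc r' => r ≠ r'
  | op _ r' _ _ => r ≠ r'
  | load r' _ => r ≠ r'
  | store _ _ => true
  | seq a b => a.keeps r && b.keeps r
  | loop c b => r ≠ c && b.keeps r

/-- Operations whose result is at most their first operand. -/
def shrinks : Op → Bool
  | .sub | .div | .mod | .and | .shr => true
  | _ => false

theorem eval_le_of_shrinks {o : Op} (h : shrinks o = true) (x y : ℕ) : o.eval x y ≤ x := by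
  cases o <;> simp_all [shrinks, Op.eval]
  · exact Nat.div_le_self x y
  · exact Nat.mod_le x y
  · exact Nat.and_le_left
  · rw [Nat.shiftRight_eq_div_pow]
    exact Nat.div_le_self x _

/-- Loops do not change their own counter, and only shrinking operations are used. -/
def Cmd.wf : Cmd → Bool
  | op o _ _ _ => shrinks o
  | seq a b => a.wf && b.wf
  | loop c b => b.keeps c && b.wf
  | _ => true

def Cmd.size : Cmd → ℕ
  | inc _ => 2
  | seq a b => a.size + b.size
  | loop _ b => b.size + 5
  | _ => 1

/-- The code of a command, to be placed at line `l`. -/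
def Cmd.compile : Cmd → ℕ → List Instr
  | set r c, _ => [.const r.idx c]
  | inc r, _ => [.const 0 1, .op .add r.idx r.idx 0]
  | op o r x y, _ => [.op o r.idx x.idx y.idx]
  | load r x, _ => [.load r.idx x.idx]
  | store r x, _ => [.store r.idx x.idx]
  | seq a b, l => a.compile l ++ b.compile (l + a.size)
  -- Register `0` is scratch: it holds `1` for the decrement, and then `0`, which turns the last
  -- conditional jump into an unconditional one.
  | loop c b, l => .jz c.idx (l + b.size + 5) :: (b.compile (l + 1) ++
      [.const 0 1, .op .sub c.idx c.idx 0, .const 0 0, .jz 0 l])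

theorem length_compile (c : Cmd) (l : ℕ) : (c.compile l).length = c.size := by
  induction c generalizing l <;> simp_all [Cmd.compile, Cmd.size]

theorem iterate_keeps {f : St → St} {c r : Reg} (hr : r ≠ c)
    (hf : ∀ s, (f s).reg r = s.reg r) (j : ℕ) (s : St) : (iterate f c j s).reg r = s.reg r := by
  induction j generalizing s with
  | zero => rfl
  | succ j ih => simp [iterate, ih, hr, hf]

theorem eval_keeps {c : Cmd} {r : Reg} (h : c.keeps r = true) (s : St) :
    (c.eval s).reg r = s.reg r := by
  induction c generalizing s with
  | seq a b iha ihb =>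
    simp only [Cmd.keeps, Bool.and_eq_true] at h
    simp only [Cmd.eval, ihb h.2, iha h.1]
  | loop c b ih =>
    simp only [Cmd.keeps, Bool.and_eq_true, decide_eq_true_eq] at h
    exact iterate_keeps h.1 (ih h.2) _ _
  | _ => simp_all [Cmd.keeps, Cmd.eval]

theorem le_iterate_t {f : St → St} {c : Reg} (hf : ∀ s, s.t ≤ (f s).t) (j : ℕ) (s : St) :
    s.t ≤ (iterate f c j s).t := by
  induction j generalizing s with
  | zero => exact Nat.le_succ _
  | succ j ih =>
    have := hf s
    have := ih { f s with reg := Function.update (f s).reg c j, t := (f s).t + 1 }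
    simp only [iterate] at this ⊢
    omega

/-- Since the clock never runs backwards, a bound on the final time bounds the time, and thereby all
values, at every intermediate state. -/
theorem le_eval_t (c : Cmd) (s : St) : s.t ≤ (c.eval s).t := by
  induction c generalizing s with
  | seq a b iha ihb => exact (iha s).trans (ihb _)
  | loop c b ih => exact le_iterate_t ih _ _
  | _ => simp [Cmd.eval, add_assoc]

/-! ### Correctness and cost of the compiled code -/

/-- The configuration `σ` represents the state `s`. -/
structure Sim (s : St) (σ : Config) : Prop where
  reg : ∀ r : Reg, σ.reg r.idx = s.reg r
  high : ∀ r, 30 ≤ r → σ.reg r = 0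
  mem : σ.mem = s.mem

/-- All values are bounded by `M` plus the time. -/
structure Bounded (M : ℕ) (s : St) : Prop where
  reg : ∀ r, s.reg r ≤ M + s.t
  mem : ∀ x, s.mem x ≤ M + s.t

theorem Sim.update {s : St} {σ : Config} (h : Sim s σ) (r : Reg) (x pc t z : ℕ) :
    Sim { s with reg := Function.update s.reg r x, t := t }
      { σ with pc := pc, reg := Function.update (Function.update σ.reg 0 z) r.idx x } where
  reg r' := by
    by_cases hr : r' = r
    · simp [hr]
    · simp only
      rw [Function.update_of_ne (fun h => hr (Reg.idx_injective h)),
        Function.update_of_ne r'.idx_pos, Function.update_of_ne hr, h.reg]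
  high r' hr := by
    have := r.idx_lt
    simp only
    rw [Function.update_of_ne (by omega), Function.update_of_ne (by omega), h.high _ hr]
  mem := h.mem

theorem Sim.update' {s : St} {σ : Config} (h : Sim s σ) (r : Reg) (x pc t : ℕ) :
    Sim { s with reg := Function.update s.reg r x, t := t }
      { σ with pc := pc, reg := Function.update σ.reg r.idx x } := by
  simpa using h.update r x pc t (σ.reg 0)

theorem Sim.scratch {s : St} {σ : Config} (h : Sim s σ) (z pc t : ℕ) :
    Sim { s with t := t } { σ with pc := pc, reg := Function.update σ.reg 0 z } where
  reg r := by simp only; rw [Function.update_of_ne r.idx_pos, h.reg]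
  high r hr := by simp only; rw [Function.update_of_ne (by omega), h.high _ hr]
  mem := h.mem

theorem Bounded.update {M : ℕ} {s : St} (h : Bounded M s) (r : Reg) {x t : ℕ} (hx : x ≤ M + t)
    (ht : s.t ≤ t) : Bounded M { s with reg := Function.update s.reg r x, t := t } where
  reg r' := by
    by_cases hr : r' = r
    · simpa [hr] using hx
    · simpa [hr] using (h.reg r').trans (by omega)
  mem x := (h.mem x).trans (by simp only; omega)

theorem Bounded.tick {M : ℕ} {s : St} (h : Bounded M s) {t : ℕ} (ht : s.t ≤ t) :
    Bounded M { s with t := t } where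
  reg r := (h.reg r).trans (by simp only; omega)
  mem x := (h.mem x).trans (by simp only; omega)

/-- The statement that the code of the command `c`, placed anywhere, does what `c` does, and takes
cost at most `H` per unit of time. -/
def Correct (M T H : ℕ) (c : Cmd) : Prop :=
  ∀ (Q : Program) (l : ℕ) (σ : Config) (s : St), CodeAt Q l (c.compile l) → σ.pc = l → Sim s σ →
    Bounded M s → (c.eval s).t ≤ T →
    ∃ cost σ', Reaches Q σ cost σ' ∧ σ'.pc = l + c.size ∧ Sim (c.eval s) σ' ∧
      Bounded M (c.eval s) ∧ cost + H * s.t ≤ H * (c.eval s).t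

/-- An upper bound for the cost of a unit of time. -/
def unitCost (M T : ℕ) : ℕ := 7 + 3 * (M + T).size

theorem correct_seq {M T H : ℕ} {a b : Cmd} (ha : Correct M T H a) (hb : Correct M T H b) :
    Correct M T H (.seq a b) := by
  intro Q l σ s hQ hpc hs hM hT
  simp only [Cmd.compile, codeAt_append, length_compile] at hQ
  simp only [Cmd.eval] at hT ⊢
  obtain ⟨c₁, σ₁, r₁, p₁, s₁, m₁, t₁⟩ := ha Q l σ s hQ.1 hpc hs hM ((le_eval_t b _).trans hT)
  obtain ⟨c₂, σ₂, r₂, p₂, s₂, m₂, t₂⟩ := hb Q _ σ₁ _ hQ.2 p₁ s₁ m₁ hT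
  exact ⟨c₁ + c₂, σ₂, r₁.trans r₂, by rw [p₂, Cmd.size]; omega, s₂, m₂, by omega⟩

/-- With `W = (M + T).size`, the five instructions around the body cost at most `(1 + W) + 2 + (2 +
2 * W) + 1 + 1 = 7 + 3 * W` per pass. This is the origin of `unitCost`, and it pays for the one unit
that `iterate` charges. -/
theorem correct_loop {M T : ℕ} {c : Reg} {b : Cmd} (hk : b.keeps c = true)
    (hb : Correct M T (unitCost M T) b) : Correct M T (unitCost M T) (.loop c b) := by
  intro Q l σ s hQ
  simp only [Cmd.eval]
  obtain ⟨j, hj⟩ : ∃ j, j = s.reg c := ⟨_, rfl⟩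
  rw [← hj]
  have hQ' := hQ
  simp only [Cmd.compile, codeAt_cons, codeAt_append, length_compile] at hQ'
  obtain ⟨q₀, qb, q₁, q₂, q₃, q₄, -⟩ := hQ'
  induction j generalizing s σ with
  | zero =>
    intro hpc hs hM hT
    simp only [iterate] at hT ⊢
    refine ⟨_, _, Reaches.step (by rw [hpc]; exact q₀), ?_, ?_, hM.tick (by omega), ?_⟩
    · simp [Instr.exec, hs.reg, ← hj, Cmd.size, add_assoc]
    · exact ⟨hs.reg, hs.high, hs.mem⟩
    · simp only [Instr.cost, hs.reg, ← hj, unitCost, Nat.size_zero, mul_add, mul_one]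
      omega
  | succ j ih =>
    intro hpc hs hM hT
    simp only [iterate] at hT ⊢
    set f := b.eval s with hf
    have hT' : f.t + 1 ≤ T := (le_iterate_t (le_eval_t b) _ _).trans hT
    have r₀ := Reaches.step (P := Q) (σ := σ) (by rw [hpc]; exact q₀)
    have s₀ : Sim s ((Instr.jz c.idx (l + b.size + 5)).exec σ) := ⟨hs.reg, hs.high, hs.mem⟩
    have p₀ : ((Instr.jz c.idx (l + b.size + 5)).exec σ).pc = l + 1 := by
      simp [Instr.exec, hs.reg, ← hj, hpc]
    obtain ⟨cb, σb, rb, pb, sb, mb, tb⟩ := hb Q (l + 1) _ s qb p₀ s₀ hM (by rw [← hf]; omega)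
    rw [← hf] at sb mb tb
    have hfc : f.reg c = j + 1 := by rw [hf, eval_keeps hk, hj]
    obtain ⟨σ₁, h₁⟩ : ∃ σ₁, (Instr.const 0 1).exec σb = σ₁ := ⟨_, rfl⟩
    obtain ⟨σ₂, h₂⟩ : ∃ σ₂, (Instr.op .sub c.idx c.idx 0).exec σ₁ = σ₂ := ⟨_, rfl⟩
    obtain ⟨σ₃, h₃⟩ : ∃ σ₃, (Instr.const 0 0).exec σ₂ = σ₃ := ⟨_, rfl⟩
    obtain ⟨σ₄, h₄⟩ : ∃ σ₄, (Instr.jz 0 l).exec σ₃ = σ₄ := ⟨_, rfl⟩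
    have p₁ : σ₁.pc = l + 1 + b.size + 1 := by rw [← h₁]; simp [Instr.exec, pb]
    have p₂ : σ₂.pc = l + 1 + b.size + 1 + 1 := by rw [← h₂]; simp [Instr.exec, p₁]
    have p₃ : σ₃.pc = l + 1 + b.size + 1 + 1 + 1 := by rw [← h₃]; simp [Instr.exec, p₂]
    have r₁ := Reaches.step (P := Q) (σ := σb) (by rw [pb]; exact q₁)
    have r₂ := Reaches.step (P := Q) (σ := σ₁) (by rw [p₁]; exact q₂)
    have r₃ := Reaches.step (P := Q) (σ := σ₂) (by rw [p₂]; exact q₃)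
    have r₄ := Reaches.step (P := Q) (σ := σ₃) (by rw [p₃]; exact q₄)
    rw [h₁] at r₁; rw [h₂] at r₂; rw [h₃] at r₃; rw [h₄] at r₄
    have s₁ : Sim f σ₁ := h₁ ▸ sb.scratch 1 _ f.t
    have z₁ : σ₁.reg 0 = 1 := by rw [← h₁]; simp [Instr.exec]
    have s₂ : Sim { f with reg := Function.update f.reg c j, t := f.t + 1 } σ₂ := by
      rw [← h₂]
      have : Op.sub.eval (σ₁.reg c.idx) (σ₁.reg 0) = j := by
        rw [s₁.reg, hfc, z₁, Op.eval, Nat.add_sub_cancel]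
      simp only [Instr.exec, this]
      exact s₁.update' c j _ _
    have s₃ : Sim { f with reg := Function.update f.reg c j, t := f.t + 1 } σ₃ :=
      h₃ ▸ s₂.scratch 0 (σ₂.pc + 1) (f.t + 1)
    have z₃ : σ₃.reg 0 = 0 := by rw [← h₃]; simp [Instr.exec]
    have s₄ : Sim { f with reg := Function.update f.reg c j, t := f.t + 1 } σ₄ := by
      rw [← h₄]
      exact ⟨s₃.reg, s₃.high, s₃.mem⟩
    have p₄ : σ₄.pc = l := by rw [← h₄]; simp [Instr.exec, z₃]
    have m₄ : Bounded M { f with reg := Function.update f.reg c j, t := f.t + 1 } :=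
      mb.update c (by have := mb.reg c; omega) (by omega)
    obtain ⟨ci, σi, ri, pi, si, mi, ti⟩ := ih σ₄ _ (by simp) p₄ s₄ m₄ hT
    refine ⟨_, σi, r₀.trans (rb.trans (r₁.trans (r₂.trans (r₃.trans (r₄.trans ri))))), pi, si, mi,
      ?_⟩
    have hW : (j + 1).size ≤ (M + T).size := by
      refine Nat.size_le_size ?_
      have := mb.reg c
      omega
    have hW' : j.size ≤ (M + T).size := (Nat.size_le_size (Nat.le_succ j)).trans hW
    simp only [mul_add, mul_one] at ti
    have hU : unitCost M T = 7 + 3 * (M + T).size := rfl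
    have e₂ : Op.sub.eval (σ₁.reg c.idx) (σ₁.reg 0) = j := by
      rw [s₁.reg, hfc, z₁, Op.eval, Nat.add_sub_cancel]
    rw [s₁.reg, hfc, z₁] at e₂
    simp only [Instr.cost, hs.reg, ← hj, e₂, s₁.reg, hfc, z₁, z₃, Nat.size_zero, Nat.size_one]
    omega

/-- Shrinking operations create no new large values, and the other commands raise the maximum by at
most the time they take. So all numbers up to time `T` are at most `M + T`, and each instruction
costs a multiple of the bit length of `M + T`. -/
theorem correct_of_wf {M T : ℕ} {c : Cmd} (hc : c.wf = true) :
    Correct M T (unitCost M T) c := by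
  have hW : ∀ {x}, x ≤ M + T → x.size ≤ (M + T).size := Nat.size_le_size
  have hU : unitCost M T = 7 + 3 * (M + T).size := rfl
  induction c with
  | seq a b iha ihb =>
    simp only [Cmd.wf, Bool.and_eq_true] at hc
    exact correct_seq (iha hc.1) (ihb hc.2)
  | loop c b ih =>
    simp only [Cmd.wf, Bool.and_eq_true] at hc
    exact correct_loop hc.1 (ih hc.2)
  | set r c =>
    intro Q l σ s hQ hpc hs hM hT
    simp only [Cmd.compile, codeAt_cons] at hQ
    simp only [Cmd.eval] at hT ⊢
    refine ⟨_, _, Reaches.step (by rw [hpc]; exact hQ.1), by simp [Instr.exec, hpc, Cmd.size],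
      hs.update' r c _ _, hM.update r (by omega) (by omega), ?_⟩
    have := hW (x := c) (by omega)
    simp only [Instr.cost, mul_add, mul_one]
    omega
  | inc r =>
    intro Q l σ s hQ hpc hs hM hT
    simp only [Cmd.compile, codeAt_cons] at hQ
    simp only [Cmd.eval] at hT ⊢
    have r₁ := Reaches.step (P := Q) (σ := σ) (by rw [hpc]; exact hQ.1)
    have r₂ := Reaches.step (P := Q) (σ := (Instr.const 0 1).exec σ)
      (by simp only [Instr.exec, hpc]; exact hQ.2.1)
    have hr := hM.reg r
    refine ⟨_, _, r₁.trans r₂, by simp [Instr.exec, hpc, Cmd.size], ?_,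
      hM.update r (by omega) (by omega), ?_⟩
    · have := hs.update r (s.reg r + 1) (σ.pc + 1 + 1) (s.t + 1) 1
      simpa [Instr.exec, Op.eval, Function.update_of_ne r.idx_pos, hs.reg] using this
    · have h₁ := hW (x := s.reg r) (by omega)
      have h₂ := hW (x := s.reg r + 1) (by omega)
      simp only [Instr.cost, Instr.exec, Op.eval, Function.update_self,
        Function.update_of_ne r.idx_pos, hs.reg, mul_add, mul_one, Nat.size_one]
      omega
  | op o r x y =>
    intro Q l σ s hQ hpc hs hM hT
    simp only [Cmd.compile, codeAt_cons] at hQ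
    simp only [Cmd.eval] at hT ⊢
    have hx := hM.reg x
    have hy := hM.reg y
    have ho := eval_le_of_shrinks hc (s.reg x) (s.reg y)
    refine ⟨_, _, Reaches.step (by rw [hpc]; exact hQ.1), by simp [Instr.exec, hpc, Cmd.size],
      ?_, hM.update r (by omega) (by omega), ?_⟩
    · simp only [Instr.exec, hs.reg]
      exact hs.update' r _ _ _
    · have h₁ := hW (x := s.reg x) (by omega)
      have h₂ := hW (x := s.reg y) (by omega)
      have h₃ := hW (x := o.eval (s.reg x) (s.reg y)) (by omega)
      simp only [Instr.cost, hs.reg, mul_add, mul_one]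
      omega
  | load r x =>
    intro Q l σ s hQ hpc hs hM hT
    simp only [Cmd.compile, codeAt_cons] at hQ
    simp only [Cmd.eval] at hT ⊢
    have hx := hM.reg x
    have hy := hM.mem (s.reg x)
    refine ⟨_, _, Reaches.step (by rw [hpc]; exact hQ.1), by simp [Instr.exec, hpc, Cmd.size],
      ?_, hM.update r (by omega) (by omega), ?_⟩
    · have := hs.update' r (s.mem (s.reg x)) (σ.pc + 1) (s.t + 1)
      simpa only [Instr.exec, hs.reg, hs.mem] using this
    · have h₁ := hW (x := s.reg x) (by omega)
      have h₂ := hW (x := s.mem (s.reg x)) (by omega)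
      simp only [Instr.cost, hs.reg, hs.mem, mul_add, mul_one]
      omega
  | store r x =>
    intro Q l σ s hQ hpc hs hM hT
    simp only [Cmd.compile, codeAt_cons] at hQ
    simp only [Cmd.eval] at hT ⊢
    have hx := hM.reg x
    have hr := hM.reg r
    refine ⟨_, _, Reaches.step (by rw [hpc]; exact hQ.1), by simp [Instr.exec, hpc, Cmd.size],
      ?_, ⟨fun r' => (hM.reg r').trans (by simp only; omega), fun y => ?_⟩, ?_⟩
    · refine ⟨hs.reg, hs.high, ?_⟩
      simp only [Instr.exec, hs.reg, hs.mem]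
    · have := hM.mem y
      simp only [Function.update_apply]
      split <;> omega
    · have h₁ := hW (x := s.reg x) (by omega)
      have h₂ := hW (x := s.reg r) (by omega)
      simp only [Instr.cost, hs.reg, mul_add, mul_one]
      omega

end LoopLang

/-! ### Relocation of programs -/

namespace RAM

theorem size_add_le (x y : ℕ) : (x + y).size ≤ x.size + y.size + 1 := by
  rw [Nat.size_le]
  have hx : x < 2 ^ x.size := Nat.lt_size_self x
  have hy : y < 2 ^ y.size := Nat.lt_size_self y
  have h₁ : 2 ^ x.size ≤ 2 ^ (x.size + y.size) := Nat.pow_le_pow_right (by norm_num) (by omega)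
  have h₂ : 2 ^ y.size ≤ 2 ^ (x.size + y.size) := Nat.pow_le_pow_right (by norm_num) (by omega)
  rw [pow_succ]
  omega

/-- The instruction with all registers shifted by `R`, with the contents of register `b` added to
all memory addresses, and with the jump target `j` replaced by `l + 2 * min j len`. -/
def Instr.relocate (R b l len : ℕ) : Instr → List Instr
  | const r c => [.const (r + R) c, .const 0 0]
  | op o r s t => [.op o (r + R) (s + R) (t + R), .const 0 0]
  | load r s => [.op .add 0 (s + R) b, .load (r + R) 0]
  | store r s => [.op .add 0 (r + R) b, .store 0 (s + R)]
  | jz r j => [.const 0 0, .jz (r + R) (l + 2 * min j len)]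

/-- Every instruction becomes exactly two, with a harmless write to scratch register `0` where one
would do, so that line `j` moves to line `l + 2 * j`. Jumps out of the program all lead to the line
behind its image. -/
theorem Instr.length_relocate (R b l len : ℕ) (i : Instr) : (i.relocate R b l len).length = 2 := by
  cases i <;> rfl

def relocate (R b l : ℕ) (P : Program) : Program := P.flatMap (Instr.relocate R b l P.length)

theorem length_relocate (R b l : ℕ) (P : Program) : (relocate R b l P).length = 2 * P.length := by
  simp [relocate, List.length_flatMap, Instr.length_relocate, mul_comm]

theorem codeAt_flatMap {Q : Program} {f : Instr → List Instr} (hf : ∀ i, (f i).length = 2)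
    {P : Program} {l : ℕ} (h : CodeAt Q l (P.flatMap f)) {j : ℕ} {i : Instr}
    (hj : P[j]? = some i) : CodeAt Q (l + 2 * j) (f i) := by
  induction P generalizing l j with
  | nil => simp at hj
  | cons i' P ih =>
    rw [List.flatMap_cons, codeAt_append, hf] at h
    cases j with
    | zero =>
      obtain rfl : i' = i := by simpa using hj
      exact h.1
    | succ j =>
      have := ih h.2 (by simpa using hj)
      rwa [show l + 2 * (j + 1) = l + 2 + 2 * j by omega]

/-- The configuration `σ'` of the relocated program represents the configuration `σ`. -/
structure Relocated (R b B l len : ℕ) (σ σ' : Config) : Prop where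
  pc : σ'.pc = l + 2 * min σ.pc len
  reg : ∀ r, σ'.reg (r + R) = σ.reg r
  base : σ'.reg b = B
  mem : ∀ x, σ'.mem (x + B) = σ.mem x

/-- By `0 < b < R`, the base register is neither the scratch register nor a shifted one, so it
survives. The cost factor comes from memory accesses, where the sum of the address and `B` is
computed and then used: at most `4 + 3 * B.size` extra bits, and three times the bits of the
address. -/
theorem Relocated.step {R b B l : ℕ} {P Q : Program} (hb : 0 < b) (hbR : b < R)
    (hQ : CodeAt Q l (relocate R b l P)) {σ σ' : Config} (h : Relocated R b B l P.length σ σ')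
    {i : Instr} (hi : P[σ.pc]? = some i) :
    ∃ t τ', Reaches Q σ' t τ' ∧ Relocated R b B l P.length (i.exec σ) τ' ∧
      t ≤ (4 + 3 * B.size) * i.cost σ := by
  have hlt : σ.pc < P.length := (List.getElem?_eq_some_iff.1 hi).1
  have hpc : σ'.pc = l + 2 * σ.pc := by rw [h.pc, min_eq_left hlt.le]
  have hmin : min (σ.pc + 1) P.length = σ.pc + 1 := min_eq_left hlt
  have hcode := codeAt_flatMap (Instr.length_relocate R b l P.length) hQ hi
  have hR : ∀ r, r + R ≠ 0 := fun r => by omega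
  have hRb : ∀ r, b ≠ r + R := fun r => by omega
  have upd : ∀ (r x z : ℕ) (r' : ℕ),
      Function.update (Function.update σ'.reg 0 z) (r + R) x (r' + R) =
        Function.update σ.reg r x r' := by
    intro r x z r'
    simp only [Function.update_apply, add_left_inj, hR, if_false, h.reg]
  have upd' : ∀ (r x z : ℕ) (r' : ℕ),
      Function.update (Function.update σ'.reg (r + R) x) 0 z (r' + R) =
        Function.update σ.reg r x r' := by
    intro r x z r'
    simp only [Function.update_apply, add_left_inj, hR, if_false, h.reg]
  cases i with
  | const r c =>
    simp only [Instr.relocate, codeAt_cons] at hcode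
    refine ⟨_, _, (Reaches.step (by rw [hpc]; exact hcode.1)).trans
      (Reaches.step (by simp only [Instr.exec, hpc]; exact hcode.2.1)), ⟨?_, ?_, ?_, ?_⟩, ?_⟩
    · simp only [Instr.exec, hpc, hmin]; omega
    · exact upd' r c 0
    · simp [Instr.exec, hb.ne', hRb, h.base]
    · exact h.mem
    · simp only [Instr.cost, Nat.size_zero]
      nlinarith [Nat.zero_le (B.size * c.size)]
  | op o r s t =>
    simp only [Instr.relocate, codeAt_cons] at hcode
    refine ⟨_, _, (Reaches.step (by rw [hpc]; exact hcode.1)).trans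
      (Reaches.step (by simp only [Instr.exec, hpc]; exact hcode.2.1)), ⟨?_, ?_, ?_, ?_⟩, ?_⟩
    · simp only [Instr.exec, hpc, hmin]; omega
    · intro r'
      simp only [Instr.exec, h.reg]
      exact upd' r _ 0 r'
    · simp [Instr.exec, hb.ne', hRb, h.base]
    · exact h.mem
    · simp only [Instr.cost, Nat.size_zero, h.reg]
      refine le_trans ?_ (Nat.mul_le_mul_right _ (show 2 ≤ 4 + 3 * B.size by omega))
      omega
  | load r s =>
    simp only [Instr.relocate, codeAt_cons] at hcode
    refine ⟨_, _, (Reaches.step (by rw [hpc]; exact hcode.1)).trans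
      (Reaches.step (by simp only [Instr.exec, hpc]; exact hcode.2.1)), ⟨?_, ?_, ?_, ?_⟩, ?_⟩
    · simp only [Instr.exec, hpc, hmin]; omega
    · intro r'
      simp only [Instr.exec, h.reg, h.base, Op.eval, Function.update_self, h.mem]
      exact upd r _ _ r'
    · simp [Instr.exec, hb.ne', hRb, h.base]
    · exact h.mem
    · simp only [Instr.cost, Instr.exec, h.reg, h.base, Op.eval, Function.update_self, h.mem]
      have := size_add_le (σ.reg s) B
      nlinarith [Nat.zero_le (B.size * (σ.reg s).size),
        Nat.zero_le (B.size * (σ.mem (σ.reg s)).size)]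
  | store r s =>
    simp only [Instr.relocate, codeAt_cons] at hcode
    refine ⟨_, _, (Reaches.step (by rw [hpc]; exact hcode.1)).trans
      (Reaches.step (by simp only [Instr.exec, hpc]; exact hcode.2.1)), ⟨?_, ?_, ?_, ?_⟩, ?_⟩
    · simp only [Instr.exec, hpc, hmin]; omega
    · intro r'
      simp only [Instr.exec, Function.update_of_ne (hR r'), h.reg]
    · simp [Instr.exec, hb.ne', h.base]
    · intro x
      simp only [Instr.exec, Op.eval, Function.update_apply, hR, if_true, if_false, h.reg, h.base,
        h.mem, add_left_inj]
    · simp only [Instr.cost, Instr.exec, h.reg, h.base, Op.eval, Function.update_self,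
        Function.update_of_ne (hR s)]
      have := size_add_le (σ.reg r) B
      nlinarith [Nat.zero_le (B.size * (σ.reg s).size), Nat.zero_le (B.size * (σ.reg r).size)]
  | jz r j =>
    simp only [Instr.relocate, codeAt_cons] at hcode
    refine ⟨_, _, (Reaches.step (by rw [hpc]; exact hcode.1)).trans
      (Reaches.step (by simp only [Instr.exec, hpc]; exact hcode.2.1)), ⟨?_, ?_, ?_, ?_⟩, ?_⟩
    · simp only [Instr.exec, Function.update_of_ne (hR r), h.reg]
      split_ifs
      · rfl
      · rw [hmin, hpc]; omega
    · intro r'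
      simp only [Instr.exec, Function.update_of_ne (hR r'), h.reg]
    · simp [Instr.exec, hb.ne', h.base]
    · exact h.mem
    · simp only [Instr.cost, Instr.exec, Nat.size_zero, Function.update_of_ne (hR r), h.reg]
      nlinarith [Nat.zero_le (B.size * (σ.reg r).size)]

theorem Relocated.halts {R b B l : ℕ} {P Q : Program} (hb : 0 < b) (hbR : b < R)
    (hQ : CodeAt Q l (relocate R b l P)) {σ τ : Config} {t : ℕ} (ht : HaltsIn P σ t τ)
    {σ' : Config} (h : Relocated R b B l P.length σ σ') :
    ∃ t' τ', Reaches Q σ' t' τ' ∧ τ'.pc = l + 2 * P.length ∧ τ'.reg R = τ.reg 0 ∧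
      t' ≤ (4 + 3 * B.size) * t := by
  induction ht generalizing σ' with
  | halt σ hn =>
    rw [List.getElem?_eq_none_iff] at hn
    refine ⟨0, σ', Reaches.refl _ _, by rw [h.pc, min_eq_right hn], ?_, Nat.zero_le _⟩
    simpa using h.reg 0
  | step σ τ i t hi _ ih =>
    obtain ⟨t₁, σ₁, r₁, h₁, c₁⟩ := h.step hb hbR hQ hi
    obtain ⟨t₂, σ₂, r₂, p₂, o₂, c₂⟩ := ih h₁
    exact ⟨_, σ₂, r₁.trans r₂, p₂, o₂, by rw [mul_add]; omega⟩

end RAM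

namespace LoopLang

open RAM

/-! ### Rules for commands -/

namespace Cmd

def mov (r x : Reg) : Cmd := .op .and r x x

/-- Repeat `b` as often as the register `r` says, with the counter `c`. -/
def times (c r : Reg) (b : Cmd) : Cmd := .seq (.mov c r) (.loop c b)

/-- Write the contents of `r` to the output. -/
def emit (r : Reg) : Cmd := .seq (.store .o r) (.inc .o)

end Cmd

open Cmd

theorem eval_seq (a b : Cmd) (s : St) : (seq a b).eval s = b.eval (a.eval s) := rfl

theorem eval_mov (r x : Reg) (s : St) :
    (mov r x).eval s = { s with reg := Function.update s.reg r (s.reg x), t := s.t + 1 } := by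
  simp [mov, eval, Op.eval]

/-- The loop itself alters the counter and the clock after each pass, so the invariant has to hold
for all values `x` and `t` of these. Registers that the body keeps need not occur in the invariant;
their initial values are available in every step. -/
theorem iterate_invariant {c : Reg} {b : Cmd} {s₀ : St} {N D : ℕ} (I : ℕ → St → Prop)
    (step : ∀ j s, j < N → (∀ r, r ≠ c → b.keeps r = true → s.reg r = s₀.reg r) → I j s →
      (b.eval s).t ≤ s.t + D ∧
        ∀ x t, I (j + 1) { b.eval s with reg := Function.update (b.eval s).reg c x, t := t })
    (j i : ℕ) (s : St) (hij : i + j = N)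
    (hk : ∀ r, r ≠ c → b.keeps r = true → s.reg r = s₀.reg r)
    (h : ∀ x t, I i { s with reg := Function.update s.reg c x, t := t }) :
    I N (iterate b.eval c j s) ∧ (iterate b.eval c j s).t ≤ s.t + j * (D + 1) + 1 := by
  induction j generalizing i s with
  | zero =>
    refine ⟨?_, by simp [iterate]⟩
    have := h (s.reg c) (s.t + 1)
    rw [Function.update_eq_self] at this
    rwa [← hij]
  | succ j ih =>
    have hi := h (s.reg c) s.t
    rw [Function.update_eq_self] at hi
    obtain ⟨ht, hI⟩ := step i s (by omega) hk hi
    have := ih (i + 1) { b.eval s with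
      reg := Function.update (b.eval s).reg c j, t := (b.eval s).t + 1 } (by omega) ?_ ?_
    · refine ⟨this.1, this.2.trans ?_⟩
      simp only [add_mul, one_mul]
      omega
    · intro r hr hb
      simp only [Function.update_of_ne hr]
      rw [eval_keeps hb, hk r hr hb]
    · intro x t
      simpa using hI x t

theorem eval_times {c r : Reg} {b : Cmd} {s : St} {N D : ℕ} (I : ℕ → St → Prop)
    (hN : s.reg r = N)
    (init : ∀ x t, I 0 { s with reg := Function.update s.reg c x, t := t })
    (step : ∀ j s', j < N → (∀ r, r ≠ c → b.keeps r = true → s'.reg r = s.reg r) → I j s' →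
      (b.eval s').t ≤ s'.t + D ∧
        ∀ x t, I (j + 1) { b.eval s' with reg := Function.update (b.eval s').reg c x, t := t }) :
    I N ((times c r b).eval s) ∧ ((times c r b).eval s).t ≤ s.t + N * (D + 1) + 2 := by
  have e : (times c r b).eval s =
      iterate b.eval c N { s with reg := Function.update s.reg c N, t := s.t + 1 } := by
    rw [times, eval, eval_mov, eval, hN]
    simp
  rw [e]
  have := iterate_invariant I step N 0 { s with reg := Function.update s.reg c N, t := s.t + 1 }
    (by omega) (fun r hr _ => by simp [hr]) (fun x t => by simpa using init x t)
  exact ⟨this.1, this.2.trans (by simp only; omega)⟩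

/-! ### Memory with a read-only part and an output list -/

/-- The memory that agrees with `m₀` below `B` and holds the list `out` from there on. -/
def outMem (m₀ : ℕ → ℕ) (B : ℕ) (out : List ℕ) : ℕ → ℕ := fun x =>
  if x < B then m₀ x else out.getD (x - B) 0

/-- Overwriting inside the output is needed because the size of a set precedes its elements but is
known only after them. -/
theorem update_outMem (m₀ : ℕ → ℕ) (B : ℕ) (out rest : List ℕ) (y y' : ℕ) :
    Function.update (outMem m₀ B (out ++ y :: rest)) (B + out.length) y' =
      outMem m₀ B (out ++ y' :: rest) := by
  funext x
  rcases eq_or_ne x (B + out.length) with rfl | hx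
  · simp [outMem]
  · rw [Function.update_of_ne hx, outMem, outMem]
    split_ifs with h
    · rfl
    · rcases lt_or_ge (x - B) out.length with h' | h'
      · rw [List.getD_append _ _ _ _ h', List.getD_append _ _ _ _ h']
      · rw [List.getD_append_right _ _ _ _ h', List.getD_append_right _ _ _ _ h']
        obtain ⟨z, hz⟩ : ∃ z, x - B - out.length = z + 1 := ⟨x - B - out.length - 1, by omega⟩
        rw [hz]
        simp

theorem update_outMem_end (m₀ : ℕ → ℕ) (B : ℕ) (out : List ℕ) (y : ℕ) :
    Function.update (outMem m₀ B out) (B + out.length) y = outMem m₀ B (out ++ [y]) := by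
  -- The cells behind the output hold the default value `0`, so appending is overwriting a final
  -- `0`.
  have : outMem m₀ B out = outMem m₀ B (out ++ 0 :: []) := by
    funext x
    simp only [outMem]
    split_ifs with h
    · rfl
    · rcases lt_or_ge (x - B) out.length with h' | h'
      · rw [List.getD_append _ _ _ _ h']
      · rw [List.getD_append_right _ _ _ _ h', List.getD_eq_default _ _ h']
        cases x - B - out.length <;> simp
  rw [this, update_outMem]

/-- The output written so far is `out`. -/
structure Output (m₀ : ℕ → ℕ) (B : ℕ) (out : List ℕ) (s : St) : Prop where
  mem : s.mem = outMem m₀ B out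
  ptr : s.reg .o = B + out.length

variable {m₀ : ℕ → ℕ} {B : ℕ} {out : List ℕ} {s s' : St}

theorem Output.congr (h : Output m₀ B out s) (hm : s'.mem = s.mem) (hp : s'.reg .o = s.reg .o) :
    Output m₀ B out s' := ⟨hm.trans h.mem, hp.trans h.ptr⟩

theorem Output.emit (h : Output m₀ B out s) {r : Reg} :
    Output m₀ B (out ++ [s.reg r]) ((emit r).eval s) where
  mem := by
    simp only [Cmd.emit, eval, h.mem, h.ptr]
    exact update_outMem_end m₀ B out _
  ptr := by simp [Cmd.emit, eval, h.ptr, add_assoc]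

theorem eval_emit_t (r : Reg) (s : St) : ((emit r).eval s).t = s.t + 2 := rfl

/-- Write the contents of `r` to the output if the flag `f` is set. -/
theorem Output.emitIf (h : Output m₀ B out s) {f r : Reg} {c : Bool} (hf : s.reg f = c.toNat)
    (hfr : f ≠ .o) :
    Output m₀ B (out ++ if c then [s.reg r] else []) ((loop f (Cmd.emit r)).eval s) ∧
      ((loop f (Cmd.emit r)).eval s).t ≤ s.t + 4 := by
  -- A loop whose counter is `0` or `1` is a conditional.
  cases c
  · simp only [Bool.toNat_false] at hf
    simp only [eval, hf, iterate, Bool.false_eq_true, if_false, List.append_nil]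
    exact ⟨⟨h.mem, h.ptr⟩, by simp⟩
  · simp only [Bool.toNat_true] at hf
    rw [eval, hf]
    simp only [iterate, if_true]
    have := h.emit (r := r)
    exact ⟨⟨this.mem, by simpa [hfr.symm] using this.ptr⟩, by simp [eval_emit_t]⟩

theorem filter_range'_succ (p : ℕ → Bool) (v j : ℕ) :
    (List.range' v (j + 1)).filter p =
      (List.range' v j).filter p ++ if p (v + j) then [v + j] else [] := by
  rw [List.range'_concat, List.filter_append, one_mul]
  congr 1
  by_cases h : p (v + j) <;> simp [h]

/-- The list `l` is stored in the memory `m` from address `p` on. -/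
def Stored (m : ℕ → ℕ) (p : ℕ) (l : List ℕ) : Prop := ∀ j < l.length, m (p + j) = l.getD j 0

theorem Stored.head {m : ℕ → ℕ} {p y : ℕ} {l : List ℕ} (h : Stored m p (y :: l)) : m p = y := by
  simpa using h 0 (by simp)

theorem Stored.tail {m : ℕ → ℕ} {p y : ℕ} {l : List ℕ} (h : Stored m p (y :: l)) :
    Stored m (p + 1) l := by
  intro j hj
  have := h (j + 1) (by simpa using hj)
  rwa [add_comm j 1, ← add_assoc, add_comm 1 j, List.getD_cons_succ] at this

theorem Stored.right {m : ℕ → ℕ} {p : ℕ} {l l' : List ℕ} (h : Stored m p (l ++ l')) :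
    Stored m (p + l.length) l' := by
  induction l generalizing p with
  | nil => exact h
  | cons y l ih =>
    have := ih (Stored.tail h)
    rwa [List.length_cons, add_comm l.length 1, ← add_assoc]

theorem Output.read (h : Output m₀ B out s) {x : ℕ} (hx : x < B) : s.mem x = m₀ x := by
  rw [h.mem, outMem, if_pos hx]

end LoopLang

namespace LoopLang

open RAM SatCover Cmd

/-! ### The reduction as a program -/

infixr:60 ";;" => Cmd.seq

variable {m₀ : ℕ → ℕ} {B : ℕ} {out : List ℕ} {s : St}

/-- Sets `flag` according to whether the literal `lit` is satisfied by the partial assignment `w` of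
the group `i`. -/
def testLiteral : Cmd :=
  op .div .a .lit .two;; op .mod .b .a .g;; op .div .a .a .g;;
  op .shr .b .w .b;; op .mod .b .b .two;;
  op .sub .d .a .i;; op .sub .flag .one .d;; op .sub .d .i .a;; op .sub .flag .flag .d;;
  op .mod .a .lit .two;;
  op .sub .d .a .b;; op .sub .flag .flag .d;; op .sub .d .b .a;; op .sub .flag .flag .d

/-- Equality is tested by truncated subtraction: `1 - (x - y) - (y - x)` is `1` if `x = y`, and `0`
otherwise. Subtracting the differences of both pairs from the same flag gives the conjunction. The
digit of `w` is read by a shift and a remainder. -/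
theorem eval_testLiteral (h₁ : s.reg .one = 1) (h₂ : s.reg .two = 2) :
    (testLiteral.eval s).reg .flag =
      (agrees (s.reg .g) (s.reg .i) (s.reg .w) (s.reg .lit)).toNat ∧
    (testLiteral.eval s).mem = s.mem ∧ (testLiteral.eval s).t = s.t + 14 := by
  refine ⟨?_, rfl, rfl⟩
  simp only [testLiteral, eval, Op.eval, Function.update_apply, reduceCtorEq, if_true, if_false,
    h₁, h₂, agrees, Nat.toNat_testBit, Nat.shiftRight_eq_div_pow]
  generalize s.reg .lit / 2 / s.reg .g = x
  generalize s.reg .w / 2 ^ (s.reg .lit / 2 % s.reg .g) % 2 = y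
  generalize s.reg .lit % 2 = z
  by_cases h : x = s.reg .i ∧ y = z
  · simp [h]
  · rw [decide_eq_false h, Bool.toNat_false]
    omega

def groupBody : Cmd :=
  (op .sub .d .lit .i;; op .sub .flag .one .d;; op .sub .d .i .lit;; op .sub .flag .flag .d);;
    loop .flag (emit .v);; inc .v;; inc .lit

/-- Output the leaf of the group `i`. -/
def emitGroup : Cmd := set .lit 0;; times .c₃ .k groupBody

def variableBody : Cmd :=
  (testLiteral;; op .sub .flag .one .flag);; loop .flag (emit .v);; inc .v;; inc .lit;; inc .lit

/-- Output the leaves of the variables. -/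
def emitVariables : Cmd := set .lit 0;; times .c₃ .kg variableBody

def literalBody : Cmd := (load .lit .p;; inc .p);; testLiteral;; loop .flag (set .sat 1)

/-- Sets `sat` according to whether the clause of length `len` at `p` is satisfied. -/
def testClause : Cmd := set .sat 0;; times .c₄ .len literalBody

def clauseBody : Cmd := (load .len .p;; inc .p);; testClause;; loop .sat (emit .v);; inc .v

/-- Output the leaves of the satisfied clauses. -/
def emitClauses : Cmd := set .p 2;; times .c₃ .m clauseBody

/-- Output the set of the partial assignment `w` of the group `i`, without its size. -/
def emitMembers : Cmd :=
  (set .v 0;; emit .v;; inc .v);; emitGroup;; emitVariables;; emitClauses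

/-- The predicate `p` will be membership in the whole set, so that the pieces written for groups,
variables and clauses combine to a filter of one range. -/
theorem eval_emitGroup {p : ℕ → Bool} (h : Output m₀ B out s) (h₁ : s.reg .one = 1)
    (hp : ∀ j < s.reg .k, p (s.reg .v + j) = decide (j = s.reg .i)) :
    Output m₀ B (out ++ (List.range' (s.reg .v) (s.reg .k)).filter p) (emitGroup.eval s) ∧
      (emitGroup.eval s).reg .v = s.reg .v + s.reg .k ∧
      (emitGroup.eval s).t ≤ s.t + 20 * (s.reg .k + 1) := by
  rw [emitGroup, eval]
  refine And.elim ?_ (eval_times (c := .c₃) (r := .k) (b := groupBody)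
    (s := (set .lit 0).eval s) (N := s.reg .k) (D := 10)
    (fun j s' => Output m₀ B (out ++ (List.range' (s.reg .v) j).filter p) s' ∧
      s'.reg .v = s.reg .v + j ∧ s'.reg .lit = j) rfl
    (fun x t => ⟨⟨by simpa [eval] using h.mem, by simpa [eval] using h.ptr⟩, by simp [eval], by simp [eval]⟩) ?_)
  · rintro ⟨hO, hv, -⟩ ht
    refine ⟨hO, hv, ht.trans ?_⟩
    simp only [eval]
    omega
  · rintro j s' hj hk ⟨hO, hv, hl⟩
    have k₁ : s'.reg .one = 1 := (hk .one (by simp) rfl).trans h₁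
    have ki : s'.reg .i = s.reg .i := hk .i (by simp) rfl
    rw [groupBody, eval]
    obtain ⟨s₁, hs₁⟩ : ∃ s₁, (op .sub .d .lit .i;; op .sub .flag .one .d;; op .sub .d .i .lit;;
      op .sub .flag .flag .d).eval s' = s₁ := ⟨_, rfl⟩
    have hf : s₁.reg .flag = (p (s.reg .v + j)).toNat := by
      rw [hp j hj, ← hs₁]
      simp only [eval, Op.eval, Function.update_apply, reduceCtorEq, if_true, if_false, k₁, ki, hl]
      by_cases h : j = s.reg .i
      · simp [h]
      · rw [decide_eq_false h, Bool.toNat_false]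
        omega
    have hO₁ : Output m₀ B _ s₁ := hO.congr (by rw [← hs₁]; rfl) (by rw [← hs₁]; rfl)
    have hv₁ : s₁.reg .v = s.reg .v + j := by rw [← hv, ← hs₁]; rfl
    have hl₁ : s₁.reg .lit = j := by rw [← hl, ← hs₁]; rfl
    have ht₁ : s₁.t = s'.t + 4 := by rw [← hs₁]; rfl
    have hE := hO₁.emitIf (r := .v) hf (by simp)
    have hv₂ := eval_keeps (c := loop .flag (emit .v)) (r := .v) rfl s₁
    have hl₂ := eval_keeps (c := loop .flag (emit .v)) (r := .lit) rfl s₁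
    rw [hv₁, List.append_assoc, ← filter_range'_succ] at hE
    rw [hs₁, eval]
    generalize (loop .flag (emit .v)).eval s₁ = s₂ at hE hv₂ hl₂ ⊢
    simp only [eval]
    refine ⟨by omega, fun x t => ⟨⟨hE.1.mem, by simpa using hE.1.ptr⟩, ?_, ?_⟩⟩
    · simp [hv₂, hv₁, add_assoc]
    · simp [hl₂, hl₁]

theorem eval_emitVariables {p : ℕ → Bool} (h : Output m₀ B out s) (h₁ : s.reg .one = 1)
    (h₂ : s.reg .two = 2)
    (hp : ∀ j < s.reg .kg,
      p (s.reg .v + j) = !agrees (s.reg .g) (s.reg .i) (s.reg .w) (2 * j)) :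
    Output m₀ B (out ++ (List.range' (s.reg .v) (s.reg .kg)).filter p) (emitVariables.eval s) ∧
      (emitVariables.eval s).reg .v = s.reg .v + s.reg .kg ∧
      (emitVariables.eval s).t ≤ s.t + 30 * (s.reg .kg + 1) := by
  rw [emitVariables, eval]
  refine And.elim ?_ (eval_times (c := .c₃) (r := .kg) (b := variableBody)
    (s := (set .lit 0).eval s) (N := s.reg .kg) (D := 22)
    (fun j s' => Output m₀ B (out ++ (List.range' (s.reg .v) j).filter p) s' ∧
      s'.reg .v = s.reg .v + j ∧ s'.reg .lit = 2 * j) rfl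
    (fun x t => ⟨⟨by simpa [eval] using h.mem, by simpa [eval] using h.ptr⟩, by simp [eval], by simp [eval]⟩) ?_)
  · rintro ⟨hO, hv, -⟩ ht
    refine ⟨hO, hv, ht.trans ?_⟩
    simp only [eval]
    omega
  · rintro j s' hj hk ⟨hO, hv, hl⟩
    have k₁ : s'.reg .one = 1 := (hk .one (by simp) rfl).trans h₁
    have k₂ : s'.reg .two = 2 := (hk .two (by simp) rfl).trans h₂
    have ki : s'.reg .i = s.reg .i := hk .i (by simp) rfl
    have kg : s'.reg .g = s.reg .g := hk .g (by simp) rfl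
    have kw : s'.reg .w = s.reg .w := hk .w (by simp) rfl
    rw [variableBody, eval]
    obtain ⟨s₁, hs₁⟩ : ∃ s₁, (testLiteral;; op .sub .flag .one .flag).eval s' = s₁ := ⟨_, rfl⟩
    have hf : s₁.reg .flag = (p (s.reg .v + j)).toNat := by
      rw [hp j hj, ← hs₁]
      have hone : (testLiteral.eval s').reg .one = 1 := k₁
      have := (eval_testLiteral k₁ k₂).1
      rw [kg, ki, kw, hl] at this
      simp only [eval, Op.eval, Function.update_self, hone, this]
      cases agrees (s.reg .g) (s.reg .i) (s.reg .w) (2 * j) <;> rfl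
    have hO₁ : Output m₀ B _ s₁ := hO.congr (by rw [← hs₁]; rfl) (by rw [← hs₁]; rfl)
    have hv₁ : s₁.reg .v = s.reg .v + j := by rw [← hv, ← hs₁]; rfl
    have hl₁ : s₁.reg .lit = 2 * j := by rw [← hl, ← hs₁]; rfl
    have ht₁ : s₁.t = s'.t + 15 := by rw [← hs₁]; rfl
    have hE := hO₁.emitIf (r := .v) hf (by simp)
    have hv₂ := eval_keeps (c := loop .flag (emit .v)) (r := .v) rfl s₁
    have hl₂ := eval_keeps (c := loop .flag (emit .v)) (r := .lit) rfl s₁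
    rw [hv₁, List.append_assoc, ← filter_range'_succ] at hE
    rw [hs₁, eval]
    generalize (loop .flag (emit .v)).eval s₁ = s₂ at hE hv₂ hl₂ ⊢
    simp only [eval]
    refine ⟨by omega, fun x t => ⟨⟨hE.1.mem, by simpa using hE.1.ptr⟩, ?_, ?_⟩⟩
    · simp [hv₂, hv₁, add_assoc]
    · simp [hl₂, hl₁, mul_add]

theorem eval_testClause (h : Output m₀ B out s) (h₁ : s.reg .one = 1) (h₂ : s.reg .two = 2)
    {C rest : List ℕ} (hC : Stored m₀ (s.reg .p) (C ++ rest))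
    (hB : s.reg .p + (C ++ rest).length = B) (hl : s.reg .len = C.length) :
    (testClause.eval s).reg .sat =
        (C.any (agrees (s.reg .g) (s.reg .i) (s.reg .w))).toNat ∧
      Output m₀ B out (testClause.eval s) ∧
      (testClause.eval s).reg .p = s.reg .p + C.length ∧
      (testClause.eval s).t ≤ s.t + 30 * (C.length + 1) := by
  rw [testClause, eval]
  refine And.elim ?_ (eval_times (c := .c₄) (r := .len) (b := literalBody)
    (s := (set .sat 0).eval s) (N := C.length) (D := 20)
    (fun j s' => s'.reg .sat =
        ((C.take j).any (agrees (s.reg .g) (s.reg .i) (s.reg .w))).toNat ∧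
      Output m₀ B out s' ∧ s'.reg .p = s.reg .p + j) hl
    (fun x t => ⟨by simp [eval], ⟨h.mem, by simpa [eval] using h.ptr⟩, by simp [eval]⟩) ?_)
  · rintro ⟨hs, hO, hp⟩ ht
    rw [List.take_length] at hs
    refine ⟨hs, hO, hp, ht.trans ?_⟩
    simp only [eval]
    omega
  · rintro j s' hj hk ⟨hs, hO, hp⟩
    have k₁ : s'.reg .one = 1 := (hk .one (by simp) rfl).trans h₁
    have k₂ : s'.reg .two = 2 := (hk .two (by simp) rfl).trans h₂
    have ki : s'.reg .i = s.reg .i := hk .i (by simp) rfl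
    have kg : s'.reg .g = s.reg .g := hk .g (by simp) rfl
    have kw : s'.reg .w = s.reg .w := hk .w (by simp) rfl
    -- The literal lies below address `B`, where the output has not changed the memory.
    have hlit : s'.mem (s'.reg .p) = C[j] := by
      rw [List.length_append] at hB
      rw [hp, hO.read (by omega), hC j (by rw [List.length_append]; omega),
        List.getD_append _ _ _ _ hj, List.getD_eq_getElem _ _ hj]
    rw [literalBody, eval]
    obtain ⟨s₁, hs₁⟩ : ∃ s₁, (load .lit .p;; inc .p).eval s' = s₁ := ⟨_, rfl⟩
    have l₁ : s₁.reg .lit = C[j] := by rw [← hlit, ← hs₁]; rfl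
    have i₁ : s₁.reg .i = s.reg .i := by rw [← ki, ← hs₁]; rfl
    have g₁ : s₁.reg .g = s.reg .g := by rw [← kg, ← hs₁]; rfl
    have w₁ : s₁.reg .w = s.reg .w := by rw [← kw, ← hs₁]; rfl
    have p₁ : s₁.reg .p = s.reg .p + (j + 1) := by
      rw [← add_assoc, ← hp, ← hs₁]; rfl
    have t₁ : s₁.t = s'.t + 2 := by rw [← hs₁]; rfl
    have st₁ : s₁.reg .sat = s'.reg .sat := by rw [← hs₁]; rfl
    have m₁ : s₁.mem = s'.mem := by rw [← hs₁]; rfl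
    have o₁ : s₁.reg .o = s'.reg .o := by rw [← hs₁]; rfl
    obtain ⟨hf, hm, ht⟩ := eval_testLiteral (s := s₁) (by rw [← k₁, ← hs₁]; rfl)
      (by rw [← k₂, ← hs₁]; rfl)
    rw [g₁, i₁, w₁, l₁] at hf
    have o₂ := eval_keeps (c := testLiteral) (r := .o) rfl s₁
    have p₂ := eval_keeps (c := testLiteral) (r := .p) rfl s₁
    have st₂ := eval_keeps (c := testLiteral) (r := .sat) rfl s₁
    rw [hs₁, eval]
    generalize testLiteral.eval s₁ = s₂ at hf hm ht o₂ p₂ st₂ ⊢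
    have hany : (C.take (j + 1)).any (agrees (s.reg .g) (s.reg .i) (s.reg .w)) =
        ((C.take j).any (agrees (s.reg .g) (s.reg .i) (s.reg .w)) ||
          agrees (s.reg .g) (s.reg .i) (s.reg .w) C[j]) := by
      rw [List.take_succ_eq_append_getElem hj, List.any_append]
      simp
    rw [hany]
    cases ha : agrees (s.reg .g) (s.reg .i) (s.reg .w) C[j]
    · rw [ha, Bool.toNat_false] at hf
      simp only [eval, hf, iterate]
      refine ⟨by omega, fun x t => ⟨?_, ⟨?_, ?_⟩, ?_⟩⟩
      · simp [st₂, st₁, hs]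
      · simp [hm, m₁, hO.mem]
      · simp [o₂, o₁, hO.ptr]
      · simp [p₂, p₁]
    · rw [ha, Bool.toNat_true] at hf
      simp only [eval, hf, iterate]
      refine ⟨by omega, fun x t => ⟨?_, ⟨?_, ?_⟩, ?_⟩⟩
      · simp
      · simp [hm, m₁, hO.mem]
      · simp [o₂, o₁, hO.ptr]
      · simp [p₂, p₁]

/-- A formula, as it is stored in the input. -/
def clauseList (cs : List (List ℕ)) : List ℕ := cs.flatMap fun C => C.length :: C

theorem clauseList_drop {cs : List (List ℕ)} {j : ℕ} (hj : j < cs.length) :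
    clauseList (cs.drop j) = cs[j].length :: (cs[j] ++ clauseList (cs.drop (j + 1))) := by
  rw [List.drop_eq_getElem_cons hj, clauseList, List.flatMap_cons]
  rfl

/-- The formula is read again for every set; the invariant is that `p` points to the clauses not yet
treated. Each clause is shorter than the input, whence `40 * (B + 1)` per pass. Such crude bounds
suffice, as they only affect polynomial factors. -/
theorem eval_emitClauses {p : ℕ → Bool} (h : Output m₀ B out s) (h₁ : s.reg .one = 1)
    (h₂ : s.reg .two = 2) {cs : List (List ℕ)} (hcs : Stored m₀ 2 (clauseList cs))
    (hB : 2 + (clauseList cs).length = B) (hm : s.reg .m = cs.length)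
    (hp : ∀ j (hj : j < cs.length),
      p (s.reg .v + j) = cs[j].any (agrees (s.reg .g) (s.reg .i) (s.reg .w))) :
    Output m₀ B (out ++ (List.range' (s.reg .v) cs.length).filter p) (emitClauses.eval s) ∧
      (emitClauses.eval s).t ≤ s.t + 50 * (B + 1) * (cs.length + 1) := by
  rw [emitClauses, eval]
  refine And.elim ?_ (eval_times (c := .c₃) (r := .m) (b := clauseBody)
    (s := (set .p 2).eval s) (N := cs.length) (D := 40 * (B + 1))
    (fun j s' => Output m₀ B (out ++ (List.range' (s.reg .v) j).filter p) s' ∧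
      s'.reg .v = s.reg .v + j ∧ Stored m₀ (s'.reg .p) (clauseList (cs.drop j)) ∧
      s'.reg .p + (clauseList (cs.drop j)).length = B) hm
    (fun x t => ⟨⟨by simpa [eval] using h.mem, by simpa [eval] using h.ptr⟩, by simp [eval], by simpa [eval] using hcs,
      by simpa [eval] using hB⟩) ?_)
  · rintro ⟨hO, -⟩ ht
    refine ⟨hO, ht.trans ?_⟩
    simp only [eval]
    nlinarith [Nat.zero_le (B * cs.length)]
  · rintro j s' hj hk ⟨hO, hv, hS, hb⟩
    have k₁ : s'.reg .one = 1 := (hk .one (by simp) rfl).trans h₁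
    have k₂ : s'.reg .two = 2 := (hk .two (by simp) rfl).trans h₂
    have ki : s'.reg .i = s.reg .i := hk .i (by simp) rfl
    have kg : s'.reg .g = s.reg .g := hk .g (by simp) rfl
    have kw : s'.reg .w = s.reg .w := hk .w (by simp) rfl
    rw [clauseList_drop hj] at hS hb
    have hlen : s'.mem (s'.reg .p) = cs[j].length := by
      rw [List.length_cons] at hb
      rw [hO.read (by omega), hS.head]
    rw [clauseBody, eval]
    obtain ⟨s₁, hs₁⟩ : ∃ s₁, (load .len .p;; inc .p).eval s' = s₁ := ⟨_, rfl⟩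
    have l₁ : s₁.reg .len = cs[j].length := by rw [← hlen, ← hs₁]; rfl
    have i₁ : s₁.reg .i = s.reg .i := by rw [← ki, ← hs₁]; rfl
    have g₁ : s₁.reg .g = s.reg .g := by rw [← kg, ← hs₁]; rfl
    have w₁ : s₁.reg .w = s.reg .w := by rw [← kw, ← hs₁]; rfl
    have p₁ : s₁.reg .p = s'.reg .p + 1 := by rw [← hs₁]; rfl
    have t₁ : s₁.t = s'.t + 2 := by rw [← hs₁]; rfl
    have v₁ : s₁.reg .v = s.reg .v + j := by rw [← hv, ← hs₁]; rfl
    have hO₁ : Output m₀ B _ s₁ := hO.congr (by rw [← hs₁]; rfl) (by rw [← hs₁]; rfl)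
    have hb₁ : s₁.reg .p + (cs[j] ++ clauseList (cs.drop (j + 1))).length = B := by
      rw [p₁, ← hb, List.length_cons]
      omega
    obtain ⟨hf, hO₂, p₂, t₂⟩ := eval_testClause hO₁ (by rw [← k₁, ← hs₁]; rfl)
      (by rw [← k₂, ← hs₁]; rfl) (p₁ ▸ hS.tail) hb₁ l₁
    rw [g₁, i₁, w₁, ← hp j hj] at hf
    have v₂ := eval_keeps (c := testClause) (r := .v) rfl s₁
    rw [hs₁, eval]
    generalize testClause.eval s₁ = s₂ at hf hO₂ p₂ t₂ v₂ ⊢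
    have hE := hO₂.emitIf (r := .v) hf (by simp)
    have v₃ := eval_keeps (c := loop .sat (emit .v)) (r := .v) rfl s₂
    have p₃ := eval_keeps (c := loop .sat (emit .v)) (r := .p) rfl s₂
    rw [v₂, v₁, List.append_assoc, ← filter_range'_succ] at hE
    rw [eval]
    generalize (loop .sat (emit .v)).eval s₂ = s₃ at hE v₃ p₃ ⊢
    have hp₃ : s₃.reg .p = s'.reg .p + 1 + cs[j].length := by rw [p₃, p₂, p₁]
    simp only [eval]
    rw [List.length_append] at hb₁
    refine ⟨by omega, fun x t => ⟨⟨hE.1.mem, by simpa using hE.1.ptr⟩, ?_, ?_, ?_⟩⟩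
    · simp [v₃, v₂, v₁, add_assoc]
    · have := hS.tail.right
      simpa [hp₃] using this
    · simp only [Function.update_apply, reduceCtorEq, if_false, hp₃]
      omega

theorem eval_emitMembers (h : Output m₀ B out s) (h₁ : s.reg .one = 1)
    (h₂ : s.reg .two = 2) {cs : List (List ℕ)} (hcs : Stored m₀ 2 (clauseList cs))
    (hB : 2 + (clauseList cs).length = B) (hm : s.reg .m = cs.length)
    (hkg : s.reg .kg = s.reg .k * s.reg .g) :
    Output m₀ B (out ++ members (s.reg .k) (s.reg .g) cs (s.reg .i) (s.reg .w))
        (emitMembers.eval s) ∧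
      (emitMembers.eval s).t ≤
        s.t + 100 * (B + 1) * (cs.length + 1 + s.reg .k + s.reg .kg) := by
  obtain ⟨p, hpdef⟩ : ∃ p, covers (s.reg .k) (s.reg .g) cs (s.reg .i) (s.reg .w) = p := ⟨_, rfl⟩
  have hsplit : members (s.reg .k) (s.reg .g) cs (s.reg .i) (s.reg .w) =
      [0] ++ (List.range' 1 (s.reg .k)).filter p ++
        (List.range' (1 + s.reg .k) (s.reg .kg)).filter p ++
        (List.range' (1 + s.reg .k + s.reg .kg) cs.length).filter p := by
    have h0 : p 0 = true := by rw [← hpdef, covers_zero]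
    have : [0] = (List.range' 0 1).filter p := by simp [h0]
    rw [members, hpdef, this, ← List.filter_append, ← List.filter_append, ← List.filter_append,
      List.range_eq_range']
    congr 1
    have e := fun a b c => List.range'_append (s := a) (m := b) (n := c) (step := 1)
    simp only [one_mul] at e
    have e₁ := e 0 1 (s.reg .k)
    have e₂ := e 0 (1 + s.reg .k) (s.reg .kg)
    have e₃ := e 0 (1 + s.reg .k + s.reg .kg) cs.length
    rw [zero_add] at e₁ e₂ e₃
    rw [e₁, e₂, e₃, leaves, hkg]
    congr 1
    omega
  rw [hsplit, emitMembers, eval]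
  obtain ⟨s₁, hs₁⟩ : ∃ s₁, (set .v 0;; emit .v;; inc .v).eval s = s₁ := ⟨_, rfl⟩
  have hO₁ : Output m₀ B (out ++ [0]) s₁ := by
    have : Output m₀ B out ((set .v 0).eval s) := ⟨h.mem, h.ptr⟩
    have := this.emit (r := .v)
    exact hs₁ ▸ ⟨this.mem, this.ptr⟩
  have t₁ : s₁.t = s.t + 4 := by rw [← hs₁]; rfl
  have v₁ : s₁.reg .v = 1 := by rw [← hs₁]; rfl
  have ke₁ : ∀ r, (set .v 0;; emit .v;; inc .v).keeps r = true → s₁.reg r = s.reg r :=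
    fun r hr => hs₁ ▸ eval_keeps hr s
  rw [hs₁, eval]
  obtain ⟨hO₂, v₂, t₂⟩ := eval_emitGroup (p := p) hO₁ ((ke₁ .one rfl).trans h₁) (by
    intro j hj
    rw [ke₁ .k rfl] at hj
    rw [v₁, ke₁ .i rfl, ← hpdef, add_comm 1 j, Bool.eq_iff_iff, covers_group hj,
      decide_eq_true_eq])
  rw [v₁, ke₁ .k rfl] at hO₂ v₂
  rw [ke₁ .k rfl] at t₂
  have ke₂ : ∀ r, (set .v 0;; emit .v;; inc .v).keeps r = true → emitGroup.keeps r = true →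
      (emitGroup.eval s₁).reg r = s.reg r := fun r hr hr' => (eval_keeps hr' s₁).trans (ke₁ r hr)
  generalize emitGroup.eval s₁ = s₂ at hO₂ v₂ t₂ ke₂ ⊢
  rw [eval]
  obtain ⟨hO₃, v₃, t₃⟩ := eval_emitVariables (p := p) hO₂ ((ke₂ .one rfl rfl).trans h₁)
    ((ke₂ .two rfl rfl).trans h₂) (by
    intro j hj
    rw [ke₂ .kg rfl rfl, hkg] at hj
    rw [v₂, ke₂ .g rfl rfl, ke₂ .i rfl rfl, ke₂ .w rfl rfl, ← hpdef, covers,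
      if_neg (by omega), if_neg (by omega), if_pos (by omega)]
    congr 3
    omega)
  rw [v₂, ke₂ .kg rfl rfl] at hO₃ v₃
  rw [ke₂ .kg rfl rfl] at t₃
  have ke₃ : ∀ r, (set .v 0;; emit .v;; inc .v).keeps r = true → emitGroup.keeps r = true →
      emitVariables.keeps r = true → (emitVariables.eval s₂).reg r = s.reg r :=
    fun r hr hr' hr'' => (eval_keeps hr'' s₂).trans (ke₂ r hr hr')
  generalize emitVariables.eval s₂ = s₃ at hO₃ v₃ t₃ ke₃ ⊢
  obtain ⟨hO₄, t₄⟩ := eval_emitClauses (p := p) hO₃ ((ke₃ .one rfl rfl rfl).trans h₁)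
    ((ke₃ .two rfl rfl rfl).trans h₂) hcs hB ((ke₃ .m rfl rfl rfl).trans hm) (by
    intro j hj
    rw [v₃, ke₃ .g rfl rfl rfl, ke₃ .i rfl rfl rfl, ke₃ .w rfl rfl rfl, ← hpdef, covers,
      if_neg (by omega), if_neg (by omega), if_neg (by rw [hkg]; omega), hkg,
      show 1 + s.reg .k + s.reg .k * s.reg .g + j - (s.reg .k + 1 + s.reg .k * s.reg .g) = j by
        omega, List.getD_eq_getElem _ _ hj])
  rw [v₃] at hO₄
  refine ⟨by simpa only [List.append_assoc] using hO₄, t₄.trans ?_⟩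
  nlinarith [Nat.zero_le (B * cs.length), Nat.zero_le (B * s.reg .k), Nat.zero_le (B * s.reg .kg)]

end LoopLang

/-! ### Output of the family of sets and of the graph -/

namespace LoopLang

open RAM SatCover Cmd

variable {m₀ : ℕ → ℕ} {B : ℕ} {out : List ℕ} {s : St}

/-- Output the set of the partial assignment `w` of the group `i`, and increase `w`. -/
def setBody : Cmd :=
  (mov .q .o;; emit .zero);; emitMembers;;
    op .sub .a .o .q;; op .sub .a .a .one;; store .q .a;; inc .w

def groupSetsBody : Cmd := set .w 0;; times .c₂ .e setBody;; inc .i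

/-- Output all sets. -/
def emitSets : Cmd := set .i 0;; times .c₁ .k groupSetsBody

/-- The encoding of a set. -/
def setCode (k g : ℕ) (cs : List (List ℕ)) (i w : ℕ) : List ℕ :=
  (members k g cs i w).length :: members k g cs i w

/-- A placeholder is written at address `q`. After the members, the distance from `q` to the end of
the output, minus one, is the size, which replaces the placeholder. -/
theorem eval_setBody (h : Output m₀ B out s) (h₁ : s.reg .one = 1)
    (h₂ : s.reg .two = 2) {cs : List (List ℕ)} (hcs : Stored m₀ 2 (clauseList cs))
    (hB : 2 + (clauseList cs).length = B) (hm : s.reg .m = cs.length)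
    (hkg : s.reg .kg = s.reg .k * s.reg .g) :
    Output m₀ B (out ++ setCode (s.reg .k) (s.reg .g) cs (s.reg .i) (s.reg .w))
        (setBody.eval s) ∧ (setBody.eval s).reg .w = s.reg .w + 1 ∧
      (setBody.eval s).t ≤
        s.t + 100 * (B + 1) * (cs.length + 1 + s.reg .k + s.reg .kg) + 10 := by
  rw [setBody, eval]
  obtain ⟨s₁, hs₁⟩ : ∃ s₁, (mov .q .o;; emit .zero).eval s = s₁ := ⟨_, rfl⟩
  have ke₁ : ∀ r, (mov .q .o;; emit .zero).keeps r = true → s₁.reg r = s.reg r :=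
    fun r hr => hs₁ ▸ eval_keeps hr s
  have hO₁ : Output m₀ B (out ++ [s.reg .zero]) s₁ := by
    have : Output m₀ B out ((mov .q .o).eval s) := ⟨h.mem, h.ptr⟩
    exact hs₁ ▸ this.emit (r := .zero)
  have q₁ : s₁.reg .q = B + out.length := by
    rw [← hs₁, eval, eval_mov]
    simp [emit, eval, h.ptr]
  have t₁ : s₁.t = s.t + 3 := by rw [← hs₁]; rfl
  have hM := eval_emitMembers hO₁ ((ke₁ .one rfl).trans h₁) ((ke₁ .two rfl).trans h₂) hcs hB
    ((ke₁ .m rfl).trans hm) (by rw [ke₁ .kg rfl, ke₁ .k rfl, ke₁ .g rfl, hkg])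
  rw [ke₁ .k rfl, ke₁ .g rfl, ke₁ .i rfl, ke₁ .w rfl, ke₁ .kg rfl] at hM
  rw [hs₁, eval]
  have q₂ := eval_keeps (c := emitMembers) (r := .q) rfl s₁
  have w₂ := eval_keeps (c := emitMembers) (r := .w) rfl s₁
  have one₂ := eval_keeps (c := emitMembers) (r := .one) rfl s₁
  rw [q₁] at q₂
  rw [ke₁ .w rfl] at w₂
  rw [ke₁ .one rfl, h₁] at one₂
  generalize emitMembers.eval s₁ = s₂ at hM q₂ w₂ one₂ ⊢
  obtain ⟨hO₂, t₂⟩ := hM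
  have ha : s₂.reg .o - s₂.reg .q - s₂.reg .one =
      (members (s.reg .k) (s.reg .g) cs (s.reg .i) (s.reg .w)).length := by
    rw [hO₂.ptr, q₂, one₂]
    simp only [List.length_append, List.length_singleton]
    omega
  rw [List.append_assoc, List.singleton_append] at hO₂
  refine ⟨⟨?_, ?_⟩, ?_, ?_⟩
  · simp only [eval, Op.eval, Function.update_apply, reduceCtorEq, if_true, if_false, ha]
    rw [hO₂.mem, q₂, update_outMem, setCode]
  · simp [eval, hO₂.ptr, setCode]
  · simp [eval, w₂]
  · simp only [eval]
    omega

theorem eval_groupSetsBody (h : Output m₀ B out s) (h₁ : s.reg .one = 1)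
    (h₂ : s.reg .two = 2) {cs : List (List ℕ)} (hcs : Stored m₀ 2 (clauseList cs))
    (hB : 2 + (clauseList cs).length = B) (hm : s.reg .m = cs.length)
    (hkg : s.reg .kg = s.reg .k * s.reg .g) :
    Output m₀ B (out ++ (List.range (s.reg .e)).flatMap
        (setCode (s.reg .k) (s.reg .g) cs (s.reg .i))) (groupSetsBody.eval s) ∧
      (groupSetsBody.eval s).reg .i = s.reg .i + 1 ∧
      (groupSetsBody.eval s).t ≤
        s.t + s.reg .e * (100 * (B + 1) * (cs.length + 1 + s.reg .k + s.reg .kg) + 11) + 4 := by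
  rw [groupSetsBody, eval_seq, eval_seq]
  obtain ⟨⟨hO, hi⟩, ht⟩ : (Output m₀ B (out ++ (List.range (s.reg .e)).flatMap
        (setCode (s.reg .k) (s.reg .g) cs (s.reg .i)))
        ((times .c₂ .e setBody).eval ((set .w 0).eval s)) ∧ _ = s.reg .e) ∧ _ :=
    eval_times (c := .c₂) (r := .e) (b := setBody)
    (s := (set .w 0).eval s) (N := s.reg .e)
    (D := 100 * (B + 1) * (cs.length + 1 + s.reg .k + s.reg .kg) + 10)
    (fun j s' => Output m₀ B (out ++ (List.range j).flatMap
        (setCode (s.reg .k) (s.reg .g) cs (s.reg .i))) s' ∧ s'.reg .w = j) rfl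
    (fun x t => ⟨⟨by simpa [eval] using h.mem, by simpa [eval] using h.ptr⟩, by simp [eval]⟩) (by
      rintro j s' hj hk ⟨hO, hw⟩
      have e₁ : s'.reg .k = s.reg .k := hk .k (by simp) rfl
      have e₂ : s'.reg .g = s.reg .g := hk .g (by simp) rfl
      have e₃ : s'.reg .kg = s.reg .kg := hk .kg (by simp) rfl
      have e₄ : s'.reg .i = s.reg .i := hk .i (by simp) rfl
      obtain ⟨hO', hw', ht⟩ := eval_setBody hO ((hk .one (by simp) rfl).trans h₁)
        ((hk .two (by simp) rfl).trans h₂) hcs hB ((hk .m (by simp) rfl).trans hm)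
        (by rw [e₁, e₂, e₃, hkg])
      rw [e₁, e₃] at ht
      rw [e₁, e₂, e₄, hw] at hO'
      refine ⟨ht, fun x t => ⟨⟨?_, ?_⟩, ?_⟩⟩
      · simp [hO'.mem, List.range_succ, List.flatMap_append]
      · simp [hO'.ptr, List.range_succ, List.flatMap_append]
      · simp [hw', hw])
  have i₂ : ((times .c₂ .e setBody).eval ((set .w 0).eval s)).reg .i = s.reg .i :=
    eval_keeps (c := times .c₂ .e setBody) (r := .i) rfl _
  generalize (times .c₂ .e setBody).eval ((set .w 0).eval s) = s₂ at hO ht i₂ ⊢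
  refine ⟨⟨hO.mem, by simpa [eval] using hO.ptr⟩, by simp [eval, i₂], ?_⟩
  simp only [eval] at ht ⊢
  linarith

theorem eval_emitSets (h : Output m₀ B out s) (h₁ : s.reg .one = 1)
    (h₂ : s.reg .two = 2) {cs : List (List ℕ)} (hcs : Stored m₀ 2 (clauseList cs))
    (hB : 2 + (clauseList cs).length = B) (hm : s.reg .m = cs.length)
    (hkg : s.reg .kg = s.reg .k * s.reg .g) :
    Output m₀ B (out ++ (List.range (s.reg .k)).flatMap fun i => (List.range (s.reg .e)).flatMap
        (setCode (s.reg .k) (s.reg .g) cs i)) (emitSets.eval s) ∧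
      (emitSets.eval s).t ≤ s.t + s.reg .k *
        (s.reg .e * (100 * (B + 1) * (cs.length + 1 + s.reg .k + s.reg .kg) + 11) + 5) + 3 := by
  rw [emitSets, eval]
  obtain ⟨⟨hO, hi⟩, ht⟩ : (Output m₀ B (out ++ (List.range (s.reg .k)).flatMap fun i =>
        (List.range (s.reg .e)).flatMap (setCode (s.reg .k) (s.reg .g) cs i))
        ((times .c₁ .k groupSetsBody).eval ((set .i 0).eval s)) ∧ _ = s.reg .k) ∧ _ :=
    eval_times (c := .c₁) (r := .k) (b := groupSetsBody)
    (s := (set .i 0).eval s) (N := s.reg .k)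
    (D := s.reg .e * (100 * (B + 1) * (cs.length + 1 + s.reg .k + s.reg .kg) + 11) + 4)
    (fun j s' => Output m₀ B (out ++ (List.range j).flatMap fun i =>
        (List.range (s.reg .e)).flatMap (setCode (s.reg .k) (s.reg .g) cs i)) s' ∧
        s'.reg .i = j) rfl
    (fun x t => ⟨⟨by simpa [eval] using h.mem, by simpa [eval] using h.ptr⟩, by simp [eval]⟩) (by
      rintro j s' hj hk ⟨hO, hw⟩
      have e₁ : s'.reg .k = s.reg .k := hk .k (by simp) rfl
      have e₂ : s'.reg .g = s.reg .g := hk .g (by simp) rfl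
      have e₃ : s'.reg .kg = s.reg .kg := hk .kg (by simp) rfl
      have e₄ : s'.reg .e = s.reg .e := hk .e (by simp) rfl
      obtain ⟨hO', hw', ht⟩ := eval_groupSetsBody hO ((hk .one (by simp) rfl).trans h₁)
        ((hk .two (by simp) rfl).trans h₂) hcs hB ((hk .m (by simp) rfl).trans hm)
        (by rw [e₁, e₂, e₃, hkg])
      rw [e₁, e₃, e₄] at ht
      rw [e₁, e₂, e₄, hw] at hO'
      refine ⟨ht, fun x t => ⟨⟨?_, ?_⟩, ?_⟩⟩
      · simp [hO'.mem, List.range_succ, List.flatMap_append]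
      · simp [hO'.ptr, List.range_succ, List.flatMap_append]
      · simp [hw', hw])
  refine ⟨hO, ht.trans ?_⟩
  simp only [eval]
  linarith

/-! ### Preparations -/

/-- Addition and multiplication do not shrink, so they are done by repeated increments. The time is
proportional to the numbers involved, which is affordable: none of them exceeds the order of the
size of the instance. -/
theorem eval_addLoop (c x r : Reg) (hrc : r ≠ c) (s : St) :
    ((times c x (inc r)).eval s).reg r = s.reg r + s.reg x ∧
      ((times c x (inc r)).eval s).mem = s.mem ∧
      ((times c x (inc r)).eval s).t ≤ s.t + 2 * s.reg x + 2 := by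
  have := eval_times (c := c) (r := x) (b := inc r) (s := s) (N := s.reg x) (D := 1)
    (fun j s' => s'.reg r = s.reg r + j ∧ s'.mem = s.mem) rfl
    (fun y t => by simp [hrc]) (by
      rintro j s' hj hk ⟨hr, hm⟩
      refine ⟨by simp [eval], fun y t => ⟨?_, hm⟩⟩
      simp [eval, hrc, hr, add_assoc])
  exact ⟨this.1.1, this.1.2, this.2.trans (by linarith)⟩

theorem eval_mulLoop (c c' x y r : Reg) (hrc : r ≠ c) (hrc' : r ≠ c') (hyc : y ≠ c) (hyc' : y ≠ c')
    (hyr : y ≠ r) (s : St) :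
    ((times c x (times c' y (inc r))).eval s).reg r = s.reg r + s.reg x * s.reg y ∧
      ((times c x (times c' y (inc r))).eval s).mem = s.mem ∧
      ((times c x (times c' y (inc r))).eval s).t ≤ s.t + s.reg x * (2 * s.reg y + 3) + 2 := by
  have := eval_times (c := c) (r := x) (b := times c' y (inc r)) (s := s) (N := s.reg x)
    (D := 2 * s.reg y + 2)
    (fun j s' => s'.reg r = s.reg r + j * s.reg y ∧ s'.mem = s.mem) rfl
    (fun y t => by simp [hrc]) (by
      rintro j s' hj hk ⟨hr, hm⟩
      have hy : s'.reg y = s.reg y := hk y hyc (by simp [times, mov, keeps, hyc', hyr])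
      obtain ⟨h₁, h₂, h₃⟩ := eval_addLoop c' y r hrc' s'
      refine ⟨by omega, fun z t => ⟨?_, h₂.trans hm⟩⟩
      simp only [Function.update_of_ne hrc, h₁, hr, hy]
      ring)
  exact ⟨this.1.1, this.1.2, this.2.trans (by linarith)⟩

def powBody : Cmd := mov .a .e;; times .c₂ .a (inc .e)

/-- Each pass doubles `e` by adding a copy of it. -/
theorem eval_powLoop (s : St) (he : s.reg .e = 1) :
    ((times .c₁ .g powBody).eval s).reg .e = 2 ^ s.reg .g ∧
      ((times .c₁ .g powBody).eval s).mem = s.mem ∧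
      ((times .c₁ .g powBody).eval s).t ≤ s.t + s.reg .g * (2 * 2 ^ s.reg .g + 4) + 2 := by
  have := eval_times (c := .c₁) (r := .g) (b := powBody) (s := s) (N := s.reg .g)
    (D := 2 * 2 ^ s.reg .g + 3)
    (fun j s' => s'.reg .e = 2 ^ j ∧ s'.mem = s.mem) rfl
    (fun y t => by simp [he]) (by
      rintro j s' hj hk ⟨hr, hm⟩
      obtain ⟨h₁, h₂, h₃⟩ := eval_addLoop .c₂ .a .e (by simp) ((mov .a .e).eval s')
      have hp : 2 ^ j ≤ 2 ^ s.reg .g := Nat.pow_le_pow_right (by norm_num) hj.le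
      simp only [eval_mov, Function.update_self, hr] at h₁ h₂ h₃
      refine ⟨?_, fun z t => ⟨?_, ?_⟩⟩
      · simp only [powBody, eval_seq, eval_mov, hr]
        omega
      · simp only [powBody, eval_seq, eval_mov, hr]
        rw [Function.update_of_ne (by simp), h₁]
        simp [hr, pow_succ]
        ring
      · simp only [powBody, eval_seq, eval_mov, hr]
        rw [h₂, hm])
  exact ⟨this.1.1, this.1.2, this.2.trans (by linarith)⟩

def endBody : Cmd := (load .len .p;; inc .p);; times .c₂ .len (inc .p)

/-- Find the end of the input. -/
def findEnd : Cmd := set .p 2;; times .c₁ .m endBody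

/-- The input does not state its own length, so its end, where the output will begin, is found by
walking from clause to clause. -/
theorem eval_findEnd {cs : List (List ℕ)} (hcs : Stored s.mem 2 (clauseList cs))
    (hB : 2 + (clauseList cs).length = B) (hm : s.reg .m = cs.length) :
    (findEnd.eval s).reg .p = B ∧ (findEnd.eval s).mem = s.mem ∧
      (findEnd.eval s).t ≤ s.t + cs.length * (2 * B + 5) + 5 := by
  have := eval_times (c := .c₁) (r := .m) (b := endBody) (s := (set .p 2).eval s)
    (N := cs.length) (D := 2 * B + 4)
    (fun j s' => s'.mem = s.mem ∧ Stored s.mem (s'.reg .p) (clauseList (cs.drop j)) ∧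
      s'.reg .p + (clauseList (cs.drop j)).length = B) hm
    (fun x t => ⟨by simp [eval], by simpa [eval] using hcs, by simpa [eval] using hB⟩) (by
      rintro j s' hj hk ⟨hmem, hS, hb⟩
      rw [clauseList_drop hj] at hS hb
      obtain ⟨s₁, hs₁⟩ : ∃ s₁, (load .len .p;; inc .p).eval s' = s₁ := ⟨_, rfl⟩
      have l₁ : s₁.reg .len = cs[j].length := by
        rw [← hS.head, ← hmem, ← hs₁]; rfl
      have p₁ : s₁.reg .p = s'.reg .p + 1 := by rw [← hs₁]; rfl
      have t₁ : s₁.t = s'.t + 2 := by rw [← hs₁]; rfl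
      have m₁ : s₁.mem = s.mem := by rw [← hmem, ← hs₁]; rfl
      obtain ⟨h₁, h₂, h₃⟩ := eval_addLoop .c₂ .len .p (by simp) s₁
      rw [l₁, p₁] at h₁
      rw [endBody, eval, hs₁]
      simp only [List.length_cons, List.length_append] at hb
      refine ⟨by omega, fun x t => ⟨h₂.trans m₁, ?_, ?_⟩⟩
      · simpa [h₁] using hS.tail.right
      · simp only [Function.update_apply, reduceCtorEq, if_false, h₁]
        omega)
  obtain ⟨⟨h₁, -, h₃⟩, ht⟩ := this
  rw [List.drop_length] at h₃
  refine ⟨h₃, h₁, ht.trans ?_⟩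
  simp only [eval]
  linarith

def edgeBody : Cmd := inc .v;; emit .zero;; emit .v

/-- Output everything that comes before the sets. -/
def emitHeader : Cmd :=
  (emit .k;; mov .a .u;; inc .a;; emit .a;; emit .u;; set .v 0);; times .c₁ .u edgeBody;;
    emit .total

theorem eval_emitHeader (h : Output m₀ B [] s) (h₀ : s.reg .zero = 0) :
    Output m₀ B ([s.reg .k, s.reg .u + 1, s.reg .u] ++
        (List.range (s.reg .u)).flatMap (fun v => [0, v + 1]) ++ [s.reg .total])
        (emitHeader.eval s) ∧
      (emitHeader.eval s).t ≤ s.t + 6 * s.reg .u + 15 := by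
  rw [emitHeader, eval]
  obtain ⟨s₁, hs₁⟩ : ∃ s₁, (emit .k;; mov .a .u;; inc .a;; emit .a;; emit .u;; set .v 0).eval s = s₁ :=
    ⟨_, rfl⟩
  have ke₁ : ∀ r, (emit .k;; mov .a .u;; inc .a;; emit .a;; emit .u;; set .v 0).keeps r = true →
      s₁.reg r = s.reg r := fun r hr => hs₁ ▸ eval_keeps hr s
  have v₁ : s₁.reg .v = 0 := by rw [← hs₁]; rfl
  have t₁ : s₁.t = s.t + 9 := by rw [← hs₁]; rfl
  have hO₁ : Output m₀ B [s.reg .k, s.reg .u + 1, s.reg .u] s₁ := by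
    have h₁ := h.emit (r := .k)
    have h₂ : Output m₀ B ([] ++ [s.reg .k]) ((mov .a .u;; inc .a).eval ((emit .k).eval s)) :=
      ⟨h₁.mem, h₁.ptr⟩
    have h₃ := (h₂.emit (r := .a)).emit (r := .u)
    have a₁ : ((mov .a .u;; inc .a).eval ((emit .k).eval s)).reg .a = s.reg .u + 1 := by
      simp [eval, emit, mov, Op.eval]
    have a₂ : ((emit .a).eval ((mov .a .u;; inc .a).eval ((emit .k).eval s))).reg .u = s.reg .u :=
      rfl
    rw [a₁, a₂] at h₃
    rw [← hs₁]
    exact ⟨h₃.mem, h₃.ptr⟩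
  rw [hs₁, eval]
  obtain ⟨⟨hO, hv⟩, ht⟩ : (Output m₀ B ([s.reg .k, s.reg .u + 1, s.reg .u] ++
        (List.range (s.reg .u)).flatMap (fun v => [0, v + 1]))
        ((times .c₁ .u edgeBody).eval s₁) ∧ _ = s.reg .u) ∧ _ :=
    eval_times (c := .c₁) (r := .u) (b := edgeBody) (s := s₁) (N := s.reg .u) (D := 5)
    (fun j s' => Output m₀ B ([s.reg .k, s.reg .u + 1, s.reg .u] ++
        (List.range j).flatMap (fun v => [0, v + 1])) s' ∧ s'.reg .v = j) (ke₁ .u rfl)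
    (fun x t => ⟨⟨by simpa using hO₁.mem, by simpa using hO₁.ptr⟩, by simp [v₁]⟩) (by
      rintro j s' hj hk ⟨hO, hv⟩
      have e₀ : s'.reg .zero = 0 := (hk .zero (by simp) rfl).trans ((ke₁ .zero rfl).trans h₀)
      have h₁ : Output m₀ B _ ((inc .v).eval s') := ⟨hO.mem, hO.ptr⟩
      have h₂ := (h₁.emit (r := .zero)).emit (r := .v)
      have e₁ : ((inc .v).eval s').reg .zero = 0 := e₀
      have e₂ : ((emit .zero).eval ((inc .v).eval s')).reg .v = j + 1 := by
        rw [← hv]; rfl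
      rw [e₁, e₂] at h₂
      refine ⟨le_rfl, fun x t => ⟨⟨?_, ?_⟩, ?_⟩⟩
      · rw [List.range_succ, List.flatMap_append]
        simpa [edgeBody, eval_seq] using h₂.mem
      · rw [List.range_succ, List.flatMap_append]
        simpa [edgeBody, eval_seq] using h₂.ptr
      · rw [← hv]; rfl)
  have e₂ : ((times .c₁ .u edgeBody).eval s₁).reg .total = s.reg .total :=
    (eval_keeps (c := times .c₁ .u edgeBody) (r := .total) rfl _).trans (ke₁ .total rfl)
  have := hO.emit (r := .total)
  rw [e₂] at this
  refine ⟨this, ?_⟩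
  rw [eval_emit_t]
  omega

end LoopLang

/-! ### The complete reduction and its running time -/

namespace LoopLang

open RAM SatCover Cmd

variable {m₀ : ℕ → ℕ} {B : ℕ} {out : List ℕ} {s : St}

/-- The parameter `k` is a constant of the program. The group size `n / k + 1` ensures that `k`
groups have room for all `n` variables. -/
def readInput (k : ℕ) : Cmd :=
  set .one 1;; set .two 2;; load .n .zero;; load .m .one;; set .k k;; op .div .g .n .k;; inc .g

def prepare (k : ℕ) : Cmd := readInput k;; findEnd;; mov .o .p;; mov .base .p

/-- Compute the number of leaves, the number of assignments of a group, and the number of sets. -/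
def computeSizes : Cmd :=
  times .c₁ .k (times .c₂ .g (inc .kg));; mov .u .kg;; times .c₁ .k (inc .u);;
    times .c₁ .m (inc .u);; set .e 1;; times .c₁ .g powBody;; times .c₁ .k (times .c₂ .e (inc .total))

/-- The reduction: it reads a formula and writes, behind it, the encoding of the instance. -/
def reduction (k : ℕ) : Cmd := prepare k;; computeSizes;; emitHeader;; emitSets

theorem wf_reduction (k : ℕ) : (reduction k).wf = true := rfl

def start (x : List ℕ) : St where
  reg := fun _ => 0
  mem := fun i => x.getD i 0
  t := 0

theorem stored_getD (x : List ℕ) : Stored (fun i => x.getD i 0) 0 x := fun j _ => by simp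

theorem eval_prepare (k n : ℕ) {cs : List (List ℕ)} {x : List ℕ}
    (hx : x = n :: cs.length :: clauseList cs) :
    let s := (prepare k).eval (start x)
    Output (fun i => x.getD i 0) x.length [] s ∧ s.reg .base = x.length ∧ s.reg .one = 1 ∧
      s.reg .two = 2 ∧ s.reg .zero = 0 ∧ s.reg .k = k ∧ s.reg .g = n / k + 1 ∧
      s.reg .m = cs.length ∧ s.reg .kg = 0 ∧ s.reg .total = 0 ∧
      s.t ≤ k + 20 + cs.length * (2 * x.length + 5) := by
  intro s
  obtain ⟨s₁, hs₁⟩ : ∃ s₁, (readInput k).eval (start x) = s₁ := ⟨_, rfl⟩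
  have hB : 2 + (clauseList cs).length = x.length := by rw [hx]; simp; omega
  have m₁ : s₁.reg .m = cs.length := by rw [← hs₁, hx]; rfl
  have mem₁ : s₁.mem = fun i => x.getD i 0 := by rw [← hs₁]; rfl
  have g₁ : s₁.reg .g = n / k + 1 := by rw [← hs₁, hx]; rfl
  have t₁ : s₁.t = k + 10 := by
    rw [← hs₁]
    simp [readInput, eval, start]
    omega
  have hS : Stored s₁.mem 2 (clauseList cs) := by
    rw [mem₁]
    have := stored_getD x
    rw [hx] at this ⊢
    exact this.tail.tail
  obtain ⟨hp, hmem, ht⟩ := eval_findEnd hS hB m₁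
  have ke : ∀ r, findEnd.keeps r = true → (findEnd.eval s₁).reg r = s₁.reg r :=
    fun r hr => eval_keeps hr s₁
  have hs : s = (mov .o .p;; mov .base .p).eval (findEnd.eval s₁) := by rw [← hs₁]; rfl
  generalize findEnd.eval s₁ = s₂ at hp hmem ht ke hs
  simp only [eval_seq, eval_mov] at hs
  rw [hs]
  refine ⟨⟨?_, ?_⟩, ?_, ?_, ?_, ?_, ?_, ?_, ?_, ?_, ?_, ?_⟩
  · simp only [hmem, mem₁]
    funext i
    rw [outMem]
    split_ifs with h
    · rfl
    · rw [List.getD_eq_default _ _ (not_lt.1 h)]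
      simp
  · simp [hp]
  · simp [hp]
  · simp [ke .one rfl, ← hs₁, readInput, eval]
  · simp [ke .two rfl, ← hs₁, readInput, eval]
  · simp [ke .zero rfl, ← hs₁, readInput, eval, start]
  · simp [ke .k rfl, ← hs₁, readInput, eval]
  · simp [ke .g rfl, g₁]
  · simp [ke .m rfl, m₁]
  · simp [ke .kg rfl, ← hs₁, readInput, eval, start]
  · simp [ke .total rfl, ← hs₁, readInput, eval, start]
  · simp only
    omega

theorem eval_computeSizes (hkg : s.reg .kg = 0) (htot : s.reg .total = 0) :
    let s' := computeSizes.eval s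
    s'.mem = s.mem ∧ s'.reg .kg = s.reg .k * s.reg .g ∧
      s'.reg .u = s.reg .k + s.reg .k * s.reg .g + s.reg .m ∧ s'.reg .e = 2 ^ s.reg .g ∧
      s'.reg .total = s.reg .k * 2 ^ s.reg .g ∧
      s'.t ≤ s.t + 2 * (s.reg .k * s.reg .g) + 5 * s.reg .k + 2 * s.reg .m +
        2 * (s.reg .g * 2 ^ s.reg .g) + 4 * s.reg .g + 2 * (s.reg .k * 2 ^ s.reg .g) +
        3 * s.reg .k + 20 := by
  simp only [computeSizes, eval_seq]
  obtain ⟨a₁, b₁, d₁⟩ := eval_mulLoop .c₁ .c₂ .k .g .kg (by simp) (by simp) (by simp) (by simp)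
    (by simp) s
  have ke₁ : ∀ r, (times .c₁ .k (times .c₂ .g (inc .kg))).keeps r = true → _ = s.reg r :=
    fun r hr => eval_keeps hr s
  generalize (times .c₁ .k (times .c₂ .g (inc .kg))).eval s = s₁ at *
  rw [eval_mov]
  obtain ⟨s₂, hs₂⟩ : ∃ s₂ : St, s₂ = { s₁ with
    reg := Function.update s₁.reg .u (s₁.reg .kg), t := s₁.t + 1 } := ⟨_, rfl⟩
  rw [← hs₂]
  have u₂ : s₂.reg .u = s.reg .k * s.reg .g := by rw [hs₂]; simp [a₁, hkg]
  have ke₂ : ∀ r, r ≠ .u → s₂.reg r = s₁.reg r := fun r hr => by rw [hs₂]; simp [hr]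
  have t₂ : s₂.t = s₁.t + 1 := by rw [hs₂]
  have m₂ : s₂.mem = s.mem := by rw [hs₂]; exact b₁
  obtain ⟨a₃, b₃, d₃⟩ := eval_addLoop .c₁ .k .u (by simp) s₂
  have ke₃ : ∀ r, (times .c₁ .k (inc .u)).keeps r = true → _ = s₂.reg r :=
    fun r hr => eval_keeps hr s₂
  generalize (times .c₁ .k (inc .u)).eval s₂ = s₃ at *
  obtain ⟨a₄, b₄, d₄⟩ := eval_addLoop .c₁ .m .u (by simp) s₃
  have ke₄ : ∀ r, (times .c₁ .m (inc .u)).keeps r = true → _ = s₃.reg r :=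
    fun r hr => eval_keeps hr s₃
  generalize (times .c₁ .m (inc .u)).eval s₃ = s₄ at *
  obtain ⟨s₅, hs₅⟩ : ∃ s₅, s₅ = (set .e 1).eval s₄ := ⟨_, rfl⟩
  rw [← hs₅]
  have ke₅ : ∀ r, (set .e 1).keeps r = true → s₅.reg r = s₄.reg r :=
    fun r hr => hs₅ ▸ eval_keeps hr s₄
  have t₅ : s₅.t = s₄.t + 2 := by rw [hs₅]; rfl
  have m₅ : s₅.mem = s₄.mem := by rw [hs₅]; rfl
  obtain ⟨a₆, b₆, d₆⟩ := eval_powLoop s₅ (by rw [hs₅]; rfl)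
  have ke₆ : ∀ r, (times .c₁ .g powBody).keeps r = true → _ = s₅.reg r :=
    fun r hr => eval_keeps hr s₅
  generalize (times .c₁ .g powBody).eval s₅ = s₆ at *
  obtain ⟨a₇, b₇, d₇⟩ := eval_mulLoop .c₁ .c₂ .k .e .total (by simp) (by simp) (by simp) (by simp)
    (by simp) s₆
  have ke₇ : ∀ r, (times .c₁ .k (times .c₂ .e (inc .total))).keeps r = true → _ = s₆.reg r :=
    fun r hr => eval_keeps hr s₆
  generalize (times .c₁ .k (times .c₂ .e (inc .total))).eval s₆ = s₇ at *
  have k₂ : s₂.reg .k = s.reg .k := by rw [ke₂ .k (by simp), ke₁ .k rfl]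
  have k₆ : s₆.reg .k = s.reg .k := by
    rw [ke₆ .k rfl, ke₅ .k rfl, ke₄ .k rfl, ke₃ .k rfl, k₂]
  have mm₃ : s₃.reg .m = s.reg .m := by rw [ke₃ .m rfl, ke₂ .m (by simp), ke₁ .m rfl]
  have g₅ : s₅.reg .g = s.reg .g := by
    rw [ke₅ .g rfl, ke₄ .g rfl, ke₃ .g rfl, ke₂ .g (by simp), ke₁ .g rfl]
  have tot₆ : s₆.reg .total = 0 := by
    rw [ke₆ .total rfl, ke₅ .total rfl, ke₄ .total rfl, ke₃ .total rfl, ke₂ .total (by simp),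
      ke₁ .total rfl, htot]
  rw [g₅] at a₆ d₆
  rw [k₆, a₆, tot₆, zero_add] at a₇
  rw [k₆, a₆] at d₇
  rw [mm₃] at a₄ d₄
  rw [k₂] at a₃ d₃
  refine ⟨by rw [b₇, b₆, m₅, b₄, b₃, m₂], ?_, ?_, ?_, a₇, ?_⟩
  · rw [ke₇ .kg rfl, ke₆ .kg rfl, ke₅ .kg rfl, ke₄ .kg rfl, ke₃ .kg rfl, ke₂ .kg (by simp), a₁, hkg,
      zero_add]
  · rw [ke₇ .u rfl, ke₆ .u rfl, ke₅ .u rfl, a₄, a₃, u₂]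
    omega
  · rw [ke₇ .e rfl, a₆]
  · simp only [mul_add, mul_left_comm _ 2] at d₁ d₆ d₇
    omega

/-- Apart from factors `k`, every product that occurs is at most `Q = X * ((L + 1) * Z)`. With the
products replaced by atoms, the claim is linear. -/
theorem reduction_time_le {k g kg L m X Z T : ℕ} (hX : 1 ≤ X) (hZ : m + 1 + k + kg = Z)
    (hg : g ≤ kg) (hT : T ≤ k + 20 + m * (2 * L + 5) + (2 * kg + 5 * k + 2 * m + 2 * (g * X) +
      4 * g + 2 * (k * X) + 3 * k + 20) + (6 * (k + kg + m) + 15) +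
      (k * (X * (100 * (L + 1) * Z + 11) + 5) + 3)) :
    T ≤ 200 * (k + 1) * (X * ((L + 1) * Z)) := by
  obtain ⟨Q, hQ⟩ : ∃ Q, X * ((L + 1) * Z) = Q := ⟨_, rfl⟩
  have q₃ : (L + 1) * Z ≤ Q := hQ ▸ Nat.le_mul_of_pos_left _ hX
  have q₁ : Z ≤ Q := (Nat.le_mul_of_pos_left Z (Nat.succ_pos L)).trans q₃
  have q₂ : Z * X ≤ Q := by
    rw [← hQ, mul_comm]
    exact Nat.mul_le_mul_left X (Nat.le_mul_of_pos_left Z (Nat.succ_pos L))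
  have q₄ : k * X ≤ Q := (Nat.mul_le_mul_right X (by omega)).trans q₂
  have q₅ : g * X ≤ Q := (Nat.mul_le_mul_right X (by omega)).trans q₂
  have q₆ : m * L ≤ Q := by
    rw [mul_comm]
    exact (Nat.mul_le_mul (Nat.le_succ L) (by omega)).trans q₃
  have e₁ : k * (X * (100 * (L + 1) * Z + 11) + 5) = 100 * (k * Q) + 11 * (k * X) + 5 * k := by
    rw [← hQ]; ring
  have e₂ : m * (2 * L + 5) = 2 * (m * L) + 5 * m := by ring
  have e₃ : 200 * (k + 1) * Q = 200 * (k * Q) + 200 * Q := by ring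
  rw [hQ, e₃]
  rw [e₁, e₂] at hT
  have : k ≤ k * Q := Nat.le_mul_of_pos_right k (by omega)
  omega

/-- The only exponential factor of the time is `2 ^ (n / k + 1)`, the number of partial assignments
of a group. -/
theorem eval_reduction {k n : ℕ} (hk : 0 < k) {cs : List (List ℕ)} {x : List ℕ}
    (hx : x = n :: cs.length :: clauseList cs) :
    let s := (reduction k).eval (start x)
    s.reg .base = x.length ∧
      (∀ a, s.mem (a + x.length) = (encoding k (n / k + 1) cs).getD a 0) ∧
      s.t ≤ 200 * (k + 1) * (2 ^ (n / k + 1) *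
        ((x.length + 1) * (cs.length + 1 + k + k * (n / k + 1)))) := by
  intro s
  have hB : 2 + (clauseList cs).length = x.length := by rw [hx]; simp; omega
  have hS : Stored (fun i => x.getD i 0) 2 (clauseList cs) := by
    have := stored_getD x
    rw [hx] at this ⊢
    exact this.tail.tail
  obtain ⟨hO, hbase, h₁, h₂, h₀, hkk, hg, hm, hkg, htot, ht⟩ := eval_prepare k n hx
  have hs : s = emitSets.eval (emitHeader.eval (computeSizes.eval ((prepare k).eval (start x)))) :=
    rfl
  generalize (prepare k).eval (start x) = s₁ at *
  obtain ⟨c₁, c₂, c₃, c₄, c₅, c₆⟩ := eval_computeSizes hkg htot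
  have ke₂ : ∀ r, computeSizes.keeps r = true → (computeSizes.eval s₁).reg r = s₁.reg r :=
    fun r hr => eval_keeps hr s₁
  simp only [hg, hkk, hm] at c₂ c₃ c₄ c₅ c₆
  generalize computeSizes.eval s₁ = s₂ at *
  obtain ⟨hO₃, t₃⟩ := eval_emitHeader (hO.congr c₁ (ke₂ .o rfl)) ((ke₂ .zero rfl).trans h₀)
  have ke₃ : ∀ r, emitHeader.keeps r = true → (emitHeader.eval s₂).reg r = s₂.reg r :=
    fun r hr => eval_keeps hr s₂
  rw [c₃, c₅, ke₂ .k rfl, hkk] at hO₃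
  generalize emitHeader.eval s₂ = s₃ at *
  obtain ⟨hO₄, t₄⟩ := eval_emitSets hO₃ (by rw [ke₃ .one rfl, ke₂ .one rfl, h₁])
    (by rw [ke₃ .two rfl, ke₂ .two rfl, h₂]) hS hB (by rw [ke₃ .m rfl, ke₂ .m rfl, hm])
    (by rw [ke₃ .kg rfl, ke₃ .k rfl, ke₂ .k rfl, ke₃ .g rfl, ke₂ .g rfl, hkk, hg, c₂])
  rw [ke₃ .k rfl, ke₂ .k rfl, hkk, ke₃ .e rfl, c₄, ke₃ .kg rfl, c₂] at t₄
  rw [ke₃ .k rfl, ke₂ .k rfl, hkk, ke₃ .e rfl, c₄, ke₃ .g rfl, ke₂ .g rfl, hg] at hO₄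
  have hb₄ : (emitSets.eval s₃).reg .base = x.length := by
    rw [eval_keeps (c := emitSets) (r := .base) rfl, ke₃ .base rfl, ke₂ .base rfl, hbase]
  rw [hs]
  refine ⟨hb₄, ?_, t₄.trans ?_⟩
  · intro a
    rw [hO₄.mem, outMem, if_neg (by omega), Nat.add_sub_cancel]
    rfl
  · rw [c₃] at t₃
    refine reduction_time_le Nat.one_le_two_pow rfl (Nat.le_mul_of_pos_left _ hk) ?_
    omega

end LoopLang

/-! ### The algorithm for satisfiability -/

namespace SatCover

open RAM LoopLang

/-- The reduction, followed by the given program on the instance. -/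
def satProgram (k : ℕ) (P : Program) : Program :=
  (reduction k).compile 0 ++ relocate 30 Reg.base.idx (reduction k).size P ++ [.op .and 0 30 30]

theorem encode_eq {n : ℕ} (φ : CNFFormula n) :
    φ.encode = n :: (codes φ).length :: clauseList (codes φ) := by
  simp [CNFFormula.encode, codes, clauseList, List.flatMap_map]

theorem length_codes_le {n : ℕ} (φ : CNFFormula n) :
    (codes φ).length + 2 ≤ φ.encode.length := by
  rw [encode_eq]
  generalize codes φ = cs
  induction cs with
  | nil => simp
  | cons C cs ih =>
    simp only [clauseList, List.flatMap_cons, List.length_cons, List.length_append] at ih ⊢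
    omega

/-- This is the initial bound `M` on all values that the cost analysis of the compiled reduction
starts from. -/
theorem encode_getD_le {n : ℕ} (φ : CNFFormula n) (i : ℕ) :
    φ.encode.getD i 0 ≤ 2 * n + φ.encode.length := by
  rcases lt_or_ge i φ.encode.length with hi | hi
  · rw [List.getD_eq_getElem _ _ hi]
    have := List.getElem_mem hi
    generalize φ.encode[i] = y at this
    rw [CNFFormula.encode, List.mem_cons, List.mem_cons, List.mem_flatMap] at this
    rcases this with rfl | rfl | ⟨C, hC, hy⟩
    · omega
    · have := length_codes_le φ
      simp only [codes, List.length_map] at this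
      omega
    · rw [List.mem_cons, List.mem_map] at hy
      rcases hy with rfl | ⟨l, -, rfl⟩
      · have h₁ := List.length_flatMap (l := φ)
          (f := fun C => C.length :: C.map fun l => 2 * (l.1 : ℕ) + l.2.toNat)
        have h₂ : C.length + 1 ≤
            (φ.map fun C => (C.length :: C.map fun l => 2 * (l.1 : ℕ) + l.2.toNat).length).sum :=
          List.single_le_sum (by simp) _ (List.mem_map.2 ⟨C, hC, by simp⟩)
        rw [CNFFormula.encode, List.length_cons, List.length_cons, h₁]
        omega
      · have := l.1.2
        have := Bool.toNat_le l.2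
        have := length_codes_le φ
        omega
  · rw [List.getD_eq_default _ _ hi]
    exact Nat.zero_le _

/-- The reduction never touches registers from `30` on, and from address `base` on the memory holds
the instance followed by zeros. So the relocated program starts in an image of its own initial
configuration. The last instruction copies its answer from register `30` to register `0`. -/
theorem satProgram_haltsIn {k n : ℕ} (hk : 0 < k) (φ : CNFFormula n) {P : Program} {t : ℕ}
    {τ : Config} (h : HaltsIn P (init (encoding k (n / k + 1) (codes φ))) t τ) :
    ∃ t' τ', HaltsIn (satProgram k P) (init φ.encode) t' τ' ∧ τ'.reg 0 = τ.reg 0 ∧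
      t' ≤ unitCost (2 * n + φ.encode.length) ((reduction k).eval (start φ.encode)).t *
          ((reduction k).eval (start φ.encode)).t +
        (4 + 3 * φ.encode.length.size) * t + (1 + 3 * (τ.reg 0).size) := by
  obtain ⟨hbase, hmem, -⟩ := eval_reduction hk (encode_eq φ)
  have code₁ : CodeAt (satProgram k P) 0 ((reduction k).compile 0) := by
    rw [satProgram, List.append_assoc]
    exact codeAt_self [] _ _
  have code₂ : CodeAt (satProgram k P) (reduction k).size
      (relocate 30 Reg.base.idx (reduction k).size P) := by
    have := codeAt_self ((reduction k).compile 0)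
      (relocate 30 Reg.base.idx (reduction k).size P) [.op .and 0 30 30]
    rwa [length_compile] at this
  have code₃ : CodeAt (satProgram k P) ((reduction k).size + 2 * P.length)
      [.op .and 0 30 30] := by
    have := codeAt_self ((reduction k).compile 0 ++
      relocate 30 Reg.base.idx (reduction k).size P) [.op .and 0 30 30] []
    rwa [List.append_nil, List.length_append, length_compile, length_relocate] at this
  obtain ⟨t₁, σ₁, r₁, p₁, s₁, -, c₁⟩ := correct_of_wf (M := 2 * n + φ.encode.length) (T := _)
    (wf_reduction k) (satProgram k P) 0 (init φ.encode) (start φ.encode) code₁ rfl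
    ⟨fun _ => rfl, fun _ _ => rfl, rfl⟩
    ⟨fun _ => Nat.zero_le _, fun i => (encode_getD_le φ i).trans (Nat.le_add_right _ _)⟩ le_rfl
  have hrel : Relocated 30 Reg.base.idx φ.encode.length (reduction k).size P.length
      (init (encoding k (n / k + 1) (codes φ))) σ₁ := by
    refine ⟨by simp [p₁, init], fun r => ?_, ?_, fun x => ?_⟩
    · rw [s₁.high _ (by omega)]
      rfl
    · rw [s₁.reg, hbase]
    · rw [s₁.mem, hmem]
      rfl
  obtain ⟨t₂, σ₂, r₂, p₂, o₂, c₂⟩ := hrel.halts (by simp [Reg.idx]) (by simp [Reg.idx]) code₂ h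
  rw [codeAt_cons] at code₃
  have r₃ := Reaches.step (P := satProgram k P) (σ := σ₂) (by rw [p₂]; exact code₃.1)
  refine ⟨_, _, r₁ _ _ (r₂ _ _ (r₃ _ _ (HaltsIn.halt _ ?_))), ?_, ?_⟩
  · rw [List.getElem?_eq_none_iff]
    simp only [satProgram, Instr.exec, p₂, List.length_append, length_compile, length_relocate,
      List.length_singleton]
    exact le_rfl
  · simp [Instr.exec, Op.eval, o₂]
  · have t₀ : (start φ.encode).t = 0 := rfl
    rw [t₀, mul_zero, add_zero] at c₁
    simp only [Instr.cost, Op.eval, o₂, Nat.and_self]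
    omega

/-! ### Estimates -/

theorem size_two_pow_mul_le (g Q : ℕ) : (2 ^ g * Q).size ≤ g + Q := by
  rw [Nat.size_le, pow_add]
  exact Nat.mul_lt_mul_of_pos_left Nat.lt_two_pow_self (by positivity)

theorem leaves_le {k n m L : ℕ} (hm : m + 2 ≤ L) :
    m + 1 + k + k * (n / k + 1) ≤ (2 * k + 2) * ((n + 1) * L) := by
  have h₁ : k * (n / k) ≤ n := Nat.mul_div_le n k
  have h₂ : k ≤ k * ((n + 1) * L) := Nat.le_mul_of_pos_right k (Nat.mul_pos (Nat.succ_pos n) (by omega))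
  have h₃ : n + L ≤ (n + 1) * L := by nlinarith
  have h₄ : (2 * k + 2) * ((n + 1) * L) = 2 * (k * ((n + 1) * L)) + 2 * ((n + 1) * L) := by ring
  have h₅ : k * (n / k + 1) = k * (n / k) + k := by ring
  omega

/-- The bit length of `T` is linear in `g` and polynomial in the rest, so the logarithmic cost adds
only a polynomial factor. -/
theorem reduction_cost_le {k n m L T : ℕ} (hm : m + 2 ≤ L)
    (hT : T ≤ 200 * (k + 1) * (2 ^ (n / k + 1) * ((L + 1) * (m + 1 + k + k * (n / k + 1))))) :
    unitCost (2 * n + L) T * T ≤ 5000000 * (k + 1) ^ 4 * (2 ^ (n / k + 1) * ((n + 1) * L) ^ 4) := by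
  obtain ⟨A, hA⟩ : ∃ A, (n + 1) * L = A := ⟨_, rfl⟩
  obtain ⟨g, hg⟩ : ∃ g, n / k + 1 = g := ⟨_, rfl⟩
  -- From `200 * (k + 1) * (2 * A) * ((2 * k + 2) * A) = 800 * (k + 1) ^ 2 * A ^ 2`.
  obtain ⟨C, hC⟩ : ∃ C, 800 * (k + 1) ^ 2 = C := ⟨_, rfl⟩
  have hlv := leaves_le (k := k) (n := n) hm
  have hA' : n + L ≤ A := by rw [← hA]; nlinarith
  have hgn : g ≤ n + 1 := by
    have := Nat.div_le_self n k
    omega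
  rw [hA] at hlv ⊢
  rw [hg] at hT hlv ⊢
  have hX : 1 ≤ 2 ^ g := Nat.one_le_two_pow
  have hT' : T ≤ 2 ^ g * (C * A ^ 2) := by
    calc T ≤ 200 * (k + 1) * (2 ^ g * ((L + 1) * (m + 1 + k + k * g))) := hT
      _ ≤ 200 * (k + 1) * (2 ^ g * ((2 * A) * ((2 * k + 2) * A))) := by
        gcongr
        omega
      _ = 2 ^ g * (C * A ^ 2) := by rw [← hC]; ring
  have hA2 : A ≤ A ^ 2 := Nat.le_self_pow (by norm_num) A
  have hsz : (2 * n + L + T).size ≤ g + (2 * A ^ 2 + C * A ^ 2) := by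
    refine le_trans (Nat.size_le_size ?_) (size_two_pow_mul_le _ _)
    rw [mul_add]
    have : 2 * A ^ 2 ≤ 2 ^ g * (2 * A ^ 2) := Nat.le_mul_of_pos_left _ hX
    omega
  have hC1 : 800 ≤ C := by
    rw [← hC]
    nlinarith [Nat.one_le_pow 2 (k + 1) (Nat.succ_pos k)]
  have hU : unitCost (2 * n + L) T ≤ 4 * C * A ^ 2 := by
    rw [unitCost]
    have : 7 + 3 * (2 * n + L + T).size ≤ 20 * A ^ 2 + 3 * (C * A ^ 2) := by omega
    refine this.trans ?_
    have : 20 * A ^ 2 ≤ C * A ^ 2 := Nat.mul_le_mul_right _ (by omega)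
    linarith
  calc unitCost (2 * n + L) T * T ≤ (4 * C * A ^ 2) * (2 ^ g * (C * A ^ 2)) :=
        Nat.mul_le_mul hU hT'
    _ = 2560000 * (k + 1) ^ 4 * (2 ^ g * A ^ 4) := by rw [← hC]; ring
    _ ≤ 5000000 * (k + 1) ^ 4 * (2 ^ g * A ^ 4) := by gcongr; norm_num

end SatCover

/-! ### Exponential bounds -/

namespace SatCover

open RAM LoopLang

theorem exists_pow_mul_poly_le {ρ θ : ℝ} (hρ : 0 < ρ) (hρθ : ρ < θ) (d : ℕ) :
    ∃ D : ℝ, 0 ≤ D ∧ ∀ n : ℕ, ρ ^ n * ((n : ℝ) + 1) ^ d ≤ D * θ ^ n := by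
  have hθ : 0 < θ := hρ.trans hρθ
  have hr0 : 0 < ρ / θ := div_pos hρ hθ
  have hr : |ρ / θ| < 1 := by rwa [abs_of_pos hr0, div_lt_one hθ]
  obtain ⟨b, hb⟩ := (tendsto_pow_const_mul_const_pow_of_abs_lt_one d hr).bddAbove_range
  have hb' : ∀ n : ℕ, (n : ℝ) ^ d * (ρ / θ) ^ n ≤ b := fun n => hb ⟨n, rfl⟩
  have hb0 : 0 ≤ b := le_trans (by positivity) (hb' 1)
  refine ⟨b / (ρ / θ), by positivity, fun n => ?_⟩
  -- The shift from `n` to `n + 1` matches the power of `n + 1` in the claim and costs the factor `ρ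
  -- / θ` in the constant.
  have := hb' (n + 1)
  push_cast at this
  rw [pow_succ, ← mul_assoc, ← le_div_iff₀ hr0, div_pow, ← mul_div_assoc,
    div_le_iff₀ (by positivity)] at this
  linarith

theorem two_pow_div_le {k : ℕ} (n : ℕ) :
    (2 : ℝ) ^ (n / k + 1) ≤ 2 * (2 : ℝ) ^ ((n : ℝ) / k) := by
  rw [pow_succ, mul_comm, ← Real.rpow_natCast]
  gcongr
  · norm_num
  · exact Nat.cast_div_le

theorem instance_size_le {k n : ℕ} (φ : CNFFormula n) :
    ((planarInstance k (n / k + 1) (codes φ)).Obj.card : ℝ) +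
        ((planarInstance k (n / k + 1) (codes φ)).n : ℝ) ≤
      (4 * k + 2) * (((n : ℝ) + 1) * φ.encode.length) * (2 : ℝ) ^ ((n : ℝ) / k) := by
  have h₁ : ((planarInstance k (n / k + 1) (codes φ)).Obj.card : ℝ) ≤ k * 2 ^ (n / k + 1) := by
    exact_mod_cast card_objects_le (k := k) (g := n / k + 1) (cs := codes φ)
  have h₂ : ((planarInstance k (n / k + 1) (codes φ)).n : ℝ) ≤
      (2 * k + 2) * (((n : ℝ) + 1) * φ.encode.length) := by
    have := leaves_le (k := k) (n := n) (length_codes_le φ)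
    have e : (planarInstance k (n / k + 1) (codes φ)).n =
        (codes φ).length + 1 + k + k * (n / k + 1) := by
      change leaves _ _ _ + 1 = _
      rw [leaves]
      omega
    rw [e]
    exact_mod_cast this
  have h₃ := two_pow_div_le (k := k) n
  have hL : (2 : ℝ) ≤ φ.encode.length := by
    have := length_codes_le φ
    exact_mod_cast (by omega : 2 ≤ φ.encode.length)
  have hA : 1 ≤ ((n : ℝ) + 1) * φ.encode.length := by
    nlinarith [Nat.cast_nonneg (α := ℝ) n]
  have hY : 1 ≤ (2 : ℝ) ^ ((n : ℝ) / k) := Real.one_le_rpow (by norm_num) (by positivity)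
  generalize ((n : ℝ) + 1) * φ.encode.length = A at *
  generalize (2 : ℝ) ^ ((n : ℝ) / k) = Y at *
  have hk : (0 : ℝ) ≤ k := Nat.cast_nonneg k
  have hYA : Y ≤ A * Y := le_mul_of_one_le_left (by linarith) hA
  have hAY : A ≤ A * Y := le_mul_of_one_le_right (by linarith) hY
  calc _ ≤ k * (2 * Y) + (2 * k + 2) * A := by
        refine add_le_add (h₁.trans ?_) h₂
        exact mul_le_mul_of_nonneg_left h₃ hk
    _ ≤ k * (2 * (A * Y)) + (2 * k + 2) * (A * Y) := by gcongr
    _ = _ := by ring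

/-- Here the gain in the exponent becomes a base below `2`: `(2 ^ (n / k)) ^ (k - δ) = (2 ^ ((k - δ)
/ k)) ^ n`. For the polynomial factor the exponent is simply rounded up to `k`. -/
theorem instance_size_rpow_le {k n : ℕ} (hk : 0 < k) (φ : CNFFormula n) {δ : ℝ} (hδ : 0 ≤ δ)
    (hδk : δ ≤ k) :
    (((planarInstance k (n / k + 1) (codes φ)).Obj.card : ℝ) +
        ((planarInstance k (n / k + 1) (codes φ)).n : ℝ)) ^ ((k : ℝ) - δ) ≤
      ((4 * k + 2) * (((n : ℝ) + 1) * φ.encode.length)) ^ k * ((2 : ℝ) ^ (((k : ℝ) - δ) / k)) ^ n := by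
  have hk' : (0 : ℝ) < k := Nat.cast_pos.2 hk
  have hL : (2 : ℝ) ≤ φ.encode.length := by
    have := length_codes_le φ
    exact_mod_cast (by omega : 2 ≤ φ.encode.length)
  have hA : 1 ≤ ((n : ℝ) + 1) * φ.encode.length := by
    nlinarith [Nat.cast_nonneg (α := ℝ) n]
  have hB : 1 ≤ (4 * k + 2) * (((n : ℝ) + 1) * φ.encode.length) := by nlinarith
  calc _ ≤ ((4 * k + 2) * (((n : ℝ) + 1) * φ.encode.length) *
        (2 : ℝ) ^ ((n : ℝ) / k)) ^ ((k : ℝ) - δ) :=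
        Real.rpow_le_rpow (by positivity) (instance_size_le φ) (by linarith)
    _ = ((4 * k + 2) * (((n : ℝ) + 1) * φ.encode.length)) ^ ((k : ℝ) - δ) *
        ((2 : ℝ) ^ ((n : ℝ) / k)) ^ ((k : ℝ) - δ) := Real.mul_rpow (by positivity) (by positivity)
    _ ≤ ((4 * k + 2) * (((n : ℝ) + 1) * φ.encode.length)) ^ (k : ℝ) *
        ((2 : ℝ) ^ ((n : ℝ) / k)) ^ ((k : ℝ) - δ) := by
        gcongr
        linarith
    _ = _ := by
        rw [Real.rpow_natCast, ← Real.rpow_mul (by norm_num), ← Real.rpow_natCast (_ ^ _ : ℝ) n,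
          ← Real.rpow_mul (by norm_num)]
        congr 2
        field_simp

/-- The reduction itself is not the bottleneck: `δ ≤ 1` and `2 ≤ k` give `1 ≤ k - δ`, so its factor
`2 ^ (n / k)` is at most `2 ^ ((k - δ) / k * n)`. -/
theorem satProgram_decidesWithin {k n : ℕ} (hk : 2 ≤ k) (φ : CNFFormula n) {P : Program}
    {F δ : ℝ} (hF : 0 ≤ F) (hδ : 0 ≤ δ) (hδ' : δ ≤ 1)
    (h : DecidesWithin P (encoding k (n / k + 1) (codes φ))
      ((planarInstance k (n / k + 1) (codes φ)).HasCover k)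
      (F * (((planarInstance k (n / k + 1) (codes φ)).Obj.card : ℝ) +
        ((planarInstance k (n / k + 1) (codes φ)).n : ℝ)) ^ ((k : ℝ) - δ))) :
    DecidesWithin (satProgram k P) φ.encode φ.Satisfiable
      ((10000000 * ((k : ℝ) + 1) ^ 4 + 7 * F * (4 * k + 2) ^ k + 4) *
        ((2 : ℝ) ^ (((k : ℝ) - δ) / k)) ^ n * (((n : ℝ) + 1) * φ.encode.length) ^ (k + 4)) := by
  obtain ⟨t, τ, ht, hT, h₁, h₀⟩ := h
  rw [hasCover_iff φ hk (Nat.lt_mul_div_succ n (by omega)).le] at h₁ h₀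
  obtain ⟨t', τ', ht', ho, hc⟩ := satProgram_haltsIn (by omega : 0 < k) φ ht
  refine ⟨t', τ', ht', ?_, fun h => (ho.trans (h₁ h)), fun h => (ho.trans (h₀ h))⟩
  have hk' : (2 : ℝ) ≤ k := by exact_mod_cast hk
  have hsz : (τ.reg 0).size ≤ 1 := by
    by_cases h : φ.Satisfiable
    · rw [h₁ h]; simp
    · rw [h₀ h]; simp
  have hred := reduction_cost_le (length_codes_le φ)
    (eval_reduction (by omega : 0 < k) (encode_eq φ)).2.2
  have hNat : t' ≤ 5000000 * (k + 1) ^ 4 * (2 ^ (n / k + 1) * ((n + 1) * φ.encode.length) ^ 4) +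
      (4 + 3 * φ.encode.length) * t + 4 := by
    have : φ.encode.length.size ≤ φ.encode.length := Nat.size_le.2 Nat.lt_two_pow_self
    have : (4 + 3 * φ.encode.length.size) * t ≤ (4 + 3 * φ.encode.length) * t :=
      Nat.mul_le_mul_right t (by omega)
    omega
  have hReal : (t' : ℝ) ≤ 5000000 * ((k : ℝ) + 1) ^ 4 * (2 ^ (n / k + 1) *
      (((n : ℝ) + 1) * φ.encode.length) ^ 4) + (4 + 3 * (φ.encode.length : ℝ)) * t + 4 := by
    exact_mod_cast hNat
  have hsize := instance_size_rpow_le (by omega : 0 < k) φ hδ (by linarith)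
  have hL : (2 : ℝ) ≤ φ.encode.length := by
    have := length_codes_le φ
    exact_mod_cast (by omega : 2 ≤ φ.encode.length)
  have hA : 1 ≤ ((n : ℝ) + 1) * φ.encode.length := by
    nlinarith [Nat.cast_nonneg (α := ℝ) n]
  have hLA : (φ.encode.length : ℝ) ≤ ((n : ℝ) + 1) * φ.encode.length :=
    le_mul_of_one_le_left (by linarith) (by linarith [Nat.cast_nonneg (α := ℝ) n])
  have hexp : (1 : ℝ) / k ≤ ((k : ℝ) - δ) / k := by gcongr; linarith
  have hY : (2 : ℝ) ^ (n / k + 1) ≤ 2 * ((2 : ℝ) ^ (((k : ℝ) - δ) / k)) ^ n := by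
    refine (two_pow_div_le n).trans ?_
    rw [← Real.rpow_natCast _ n, ← Real.rpow_mul (by norm_num)]
    gcongr
    · norm_num
    · calc (n : ℝ) / k = 1 / k * n := by ring
        _ ≤ _ := by gcongr
  have hR : 1 ≤ ((2 : ℝ) ^ (((k : ℝ) - δ) / k)) ^ n :=
    one_le_pow₀ (Real.one_le_rpow (by norm_num) (le_trans (by positivity) hexp))
  have ht₁ := hT.trans (mul_le_mul_of_nonneg_left hsize hF)
  generalize ((2 : ℝ) ^ (((k : ℝ) - δ) / k)) ^ n = R at *
  generalize ((n : ℝ) + 1) * φ.encode.length = A at *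
  rw [mul_pow] at ht₁
  have p₁ : A ^ 4 ≤ A ^ (k + 4) := pow_le_pow_right₀ hA (by omega)
  have p₂ : A ^ (k + 1) ≤ A ^ (k + 4) := pow_le_pow_right₀ hA (by omega)
  have p₃ : 1 ≤ R * A ^ (k + 4) := one_le_mul_of_one_le_of_one_le hR (one_le_pow₀ hA)
  calc (t' : ℝ) ≤ _ := hReal
    _ ≤ 5000000 * ((k : ℝ) + 1) ^ 4 * ((2 * R) * A ^ (k + 4)) +
        (7 * A) * (F * ((4 * k + 2) ^ k * A ^ k * R)) + 4 * (R * A ^ (k + 4)) := by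
      have : 4 + 3 * (φ.encode.length : ℝ) ≤ 7 * A := by linarith
      gcongr
      linarith
    _ = 10000000 * ((k : ℝ) + 1) ^ 4 * R * A ^ (k + 4) +
        7 * F * (4 * k + 2) ^ k * R * A ^ (k + 1) + 4 * R * A ^ (k + 4) := by ring
    _ ≤ 10000000 * ((k : ℝ) + 1) ^ 4 * R * A ^ (k + 4) +
        7 * F * (4 * k + 2) ^ k * R * A ^ (k + 4) + 4 * R * A ^ (k + 4) := by gcongr
    _ = _ := by ring

end SatCover

/-! ### The contradiction with SETH -/

open RAM SatCover in
/-- `K` is the set of parameter values for which the algorithm is required to work, so that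
`K = Set.univ` is the claim for algorithms that take an arbitrary `k`, and `K = {k}` is the claim
for a single fixed `k`. The function `f` need not be computable. -/
theorem mainTheorem12 (hSETH : SETH) (f : ℕ → ℕ) (ε : ℝ) (hε : 0 < ε)
    (K : Set ℕ) (hK : ∃ k ∈ K, 2 ≤ k) :
    ¬ ∃ P : RAM.Program, ∀ k ∈ K, ∀ (I : PlanarCoverInstance) (x : List ℕ),
      I.IsEncoding k x →
        RAM.DecidesWithin P x (I.HasCover k)
          (f k * ((I.Obj.card : ℝ) + (I.n : ℝ)) ^ ((k : ℝ) - ε)) := by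
  rintro ⟨P, hP⟩
  obtain ⟨k, hkK, hk⟩ := hK
  have hk' : (2 : ℝ) ≤ k := by exact_mod_cast hk
  -- As the instance size is at least `1`, a smaller saving in the exponent is a weaker bound, so
  -- the saving may be capped at `1`.
  obtain ⟨δ, hδ⟩ : ∃ δ, min ε 1 = δ := ⟨_, rfl⟩
  have hδ0 : 0 < δ := hδ ▸ lt_min hε one_pos
  have hδ1 : δ ≤ 1 := hδ ▸ min_le_right _ _
  have hδε : δ ≤ ε := hδ ▸ min_le_left _ _
  obtain ⟨ρ, hρ⟩ : ∃ ρ : ℝ, (2 : ℝ) ^ (((k : ℝ) - δ) / k) = ρ := ⟨_, rfl⟩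
  have hρ0 : 0 < ρ := hρ ▸ Real.rpow_pos_of_pos (by norm_num) _
  have hρ2 : ρ < 2 := by
    rw [← hρ]
    conv_rhs => rw [← Real.rpow_one 2]
    refine Real.rpow_lt_rpow_of_exponent_lt (by norm_num) ?_
    rw [div_lt_one (by linarith)]
    linarith
  -- The base `2 - (1 - ρ / 2) = 1 + ρ / 2` lies halfway between `ρ` and `2`; the gap above `ρ`
  -- absorbs the power of `n + 1`.
  obtain ⟨D, hD, hDn⟩ := exists_pow_mul_poly_le hρ0 (show ρ < 2 - (1 - ρ / 2) by linarith) (k + 4)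
  obtain ⟨C, hC⟩ : ∃ C : ℝ, 10000000 * ((k : ℝ) + 1) ^ 4 + 7 * (f k : ℝ) * (4 * k + 2) ^ k + 4 = C :=
    ⟨_, rfl⟩
  have hC0 : 0 ≤ C := by rw [← hC]; positivity
  refine hSETH (1 - ρ / 2) (by linarith) (by linarith)
    -- In `SETH` one number is both the constant factor and the exponent of the length, hence the
    -- maximum.
    ⟨satProgram k P, max ⌈C * D⌉₊ (k + 4), fun n φ => ?_⟩
  have hdec := hP k hkK _ _ (isEncoding_encoding (k := k) (g := n / k + 1) (cs := codes φ))
  have hle : DecidesWithin P (encoding k (n / k + 1) (codes φ))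
      ((planarInstance k (n / k + 1) (codes φ)).HasCover k)
      (f k * (((planarInstance k (n / k + 1) (codes φ)).Obj.card : ℝ) +
        ((planarInstance k (n / k + 1) (codes φ)).n : ℝ)) ^ ((k : ℝ) - δ)) := by
    obtain ⟨t, τ, h₁, h₂, h₃⟩ := hdec
    refine ⟨t, τ, h₁, h₂.trans ?_, h₃⟩
    have hn : (1 : ℝ) ≤ (planarInstance k (n / k + 1) (codes φ)).n := by
      exact_mod_cast (planarInstance k (n / k + 1) (codes φ)).n_pos
    gcongr
    linarith [Nat.cast_nonneg (α := ℝ) (planarInstance k (n / k + 1) (codes φ)).Obj.card]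
  have hsat := satProgram_decidesWithin hk φ (Nat.cast_nonneg _) hδ0.le hδ1 hle
  rw [hρ, hC] at hsat
  obtain ⟨t, τ, h₁, h₂, h₃⟩ := hsat
  refine ⟨t, τ, h₁, h₂.trans ?_, h₃⟩
  have hL : (1 : ℝ) ≤ φ.encode.length := by
    have := length_codes_le φ
    exact_mod_cast (by omega : 1 ≤ φ.encode.length)
  have hθ : (0 : ℝ) ≤ 2 - (1 - ρ / 2) := by linarith
  calc C * ρ ^ n * (((n : ℝ) + 1) * φ.encode.length) ^ (k + 4)
      = C * (ρ ^ n * ((n : ℝ) + 1) ^ (k + 4)) * (φ.encode.length : ℝ) ^ (k + 4) := by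
        rw [mul_pow]; ring
    _ ≤ C * (D * (2 - (1 - ρ / 2)) ^ n) * (φ.encode.length : ℝ) ^ (k + 4) := by
        gcongr C * ?_ * _
        exact hDn n
    _ = C * D * (2 - (1 - ρ / 2)) ^ n * (φ.encode.length : ℝ) ^ (k + 4) := by ring
    _ ≤ (max ⌈C * D⌉₊ (k + 4) : ℕ) * (2 - (1 - ρ / 2)) ^ n *
        (φ.encode.length : ℝ) ^ (max ⌈C * D⌉₊ (k + 4)) := by
        gcongr
        · exact (Nat.le_ceil _).trans (by exact_mod_cast le_max_left _ _)
        · exact le_max_right _ _
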